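/- **Setting.** Let $M$ be a smooth manifold, $\gamma$ a closed 3-form on $M$, and let $\mathbb{T}M=TM\oplus T^*M$ carry the pairing $\langle X+\xi,Y+\eta\rangle=\tfrac12(\eta(X)+\xi(Y))$ and the Courant–Dorfman bracket $(X+\xi)*(Y+\eta)=[X,Y]+\mathcal L_X\eta-\iota_Yd\xi+\iota_X\iota_Y\gamma$, both extended complex-linearly to $\mathbb{T}M\otimes\mathbb{C}$; let $a$ denote the projection to $TM$ (or $TM\otimes\mathbb C$). Let $(\mathbb J,\mathbb J')$ be a generalized Kähler structure on $M$: commuting orthogonal smooth endomorphisms of $\mathbb{T}M$ with square $-1$ whose $i$-eigenbundles $L$, $L'$ are closed under $*$, and such that $\langle\mathbb G\,\cdot,\cdot\rangle$ is positive definite for $\mathbb G=-\mathbb J\mathbb J'$. Let $C_\pm$ be the $\pm1$-eigenbundles of $\mathbb G$. The projections $a_\pm=a|_{C_\pm}:C_\pm\to TM$ are isomorphisms, and $g(X,Y)=\langle a_+^{-1}X,a_+^{-1}Y\rangle=-\langle a_-^{-1}X,a_-^{-1}Y\rangle$, $I_\pm=a\circ\mathbb J\circ a_\pm^{-1}$ is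 the associated bi-Hermitian structure. Write $T^\pm_{0,1}M\subset TM\otimes\mathbb C$ for the $-i$-eigenbundle of $I_\pm$, $T_\pm^{0,1}M$ for its dual, and $\bar\ell_+=\bar L\cap\bar L'$, $\bar\ell_-=\bar L\cap L'$, so that $\bar L=\bar\ell_+\oplus\bar\ell_-$ and $a:\bar\ell_\pm\to T^\pm_{0,1}M$ is an isomorphism. Let $\nabla^\pm$ be the Bismut connection of $(M,g,I_\pm)$, i.e. the connection on $TM$ with $\nabla^\pm g=0$, $\nabla^\pm I_\pm=0$ and totally skew-symmetric torsion, extended complex-linearly. Let $V$ be a smooth complex vector bundle on $M$. A *$\mathbb J$-holomorphic structure* on $V$ is a derivation $\bar{\mathcal D}:C^\infty(V)\to C^\infty(V\otimes\bar L^*)$, $\bar{\mathcal D}_s(fv)=f\bar{\mathcal D}_sv+(a(s)f)v$, that is flat: $\bar{\mathcal D}_s\bar{\mathcal D}_tv-\bar{\mathcal D}_t\bar{\mathcal D}_sv=\bar{\mathcal D}_{s*t}v$ for all $s,t\in C^\infty(\bar L)$. An *$I_\pm$-holomorphic structure* on $V$ is a pair $(\bar\partial_+,\bar\partial_-)$ of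 holomorphic structures $\bar\partial_\pm:C^\infty(V)\to C^\infty(V\otimes T_\pm^{0,1}M)$, $\bar\partial_\pm^2=0$, with respect to $I_+$ and $I_-$. Let $\bar\delta_\pm:C^\infty(T_\pm^{0,1}M)\to C^\infty(T_\mp^{0,1}M\otimes T_\pm^{0,1}M)$ be the component of the connection induced by $\nabla^\pm$ on forms, $(\bar\delta_\pm\alpha)(X,Y)=X(\alpha(Y))-\alpha(\nabla^\pm_XY)$ for $X\in C^\infty(T^\mp_{0,1}M)$, $Y\in C^\infty(T^\pm_{0,1}M)$, and extend $\bar\partial_\mp$ to $\bar\partial_\mp:C^\infty(V\otimes T_\pm^{0,1}M)\to C^\infty(V\otimes T_\mp^{0,1}M\otimes T_\pm^{0,1}M)$ by $\bar\partial_\mp(v\otimes\alpha)=\bar\partial_\mp v\otimes\alpha+v\otimes\bar\delta_\pm\alpha$. **Proposition.** $\mathbb J$-holomorphic structures on $V$ are exactly the $I_\pm$-holomorphic structures on $V$ that satisfy the commutation relation $$[\bar\partial_+,\bar\partial_-]:=\bar\partial_+\bar\partial_-+\bar\partial_-\bar\partial_+=0$$ on $C^\infty(V)$, where $T_-^{0,1}M\otimes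 T_+^{0,1}M$ is identified with $T_+^{0,1}M\otimes T_-^{0,1}M$ via $\beta\otimes\alpha\mapsto-\alpha\otimes\beta$. That is, there is a bijection, $\bar{\mathcal D}\mapsto(\bar\partial_+,\bar\partial_-)$, between the $\mathbb J$-holomorphic structures on $V$ and the $I_\pm$-holomorphic structures on $V$ that satisfy the commutation relation, given by $\bar\partial_{\pm,X}v=\bar{\mathcal D}_sv$ for $s\in C^\infty(\bar\ell_\pm)$ and $X=a(s)$. -/

import Mathlib

open Bundle Set Module
open scoped Manifold ContDiff

noncomputable section

namespace GK

/-! ### Complexification of a real vector space -/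

/-- The complexification `W ⊗ ℂ` of a real vector space: the pair `(u, v)` stands for `u + i v`. -/
def Cx (W : Type*) : Type _ := W × W

namespace Cx

variable {W W' : Type*}

/-- The vector `u + i v`. -/
def mk (u v : W) : Cx W := (u, v)

/-- Real part. -/
def re (w : Cx W) : W := w.1

/-- Imaginary part. -/
def im (w : Cx W) : W := w.2

@[ext] theorem ext {a b : Cx W} (h₁ : a.re = b.re) (h₂ : a.im = b.im) : a = b := Prod.ext h₁ h₂

@[simp] theorem mk_re (u v : W) : (mk u v).re = u := rfl
@[simp] theorem mk_im (u v : W) : (mk u v).im = v := rfl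

instance [AddCommGroup W] : AddCommGroup (Cx W) := inferInstanceAs (AddCommGroup (W × W))

section
variable [AddCommGroup W]
@[simp] theorem zero_re : (0 : Cx W).re = 0 := rfl
@[simp] theorem zero_im : (0 : Cx W).im = 0 := rfl
@[simp] theorem add_re (a b : Cx W) : (a + b).re = a.re + b.re := rfl
@[simp] theorem add_im (a b : Cx W) : (a + b).im = a.im + b.im := rfl
@[simp] theorem neg_re (a : Cx W) : (-a).re = -a.re := rfl
@[simp] theorem neg_im (a : Cx W) : (-a).im = -a.im := rfl
@[simp] theorem sub_re (a b : Cx W) : (a - b).re = a.re - b.re := rfl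
@[simp] theorem sub_im (a b : Cx W) : (a - b).im = a.im - b.im := rfl
end

variable [AddCommGroup W] [Module ℝ W] [AddCommGroup W'] [Module ℝ W']

instance : SMul ℂ (Cx W) :=
  ⟨fun z w => mk (z.re • w.re - z.im • w.im) (z.re • w.im + z.im • w.re)⟩

@[simp] theorem smul_re (z : ℂ) (w : Cx W) : (z • w).re = z.re • w.re - z.im • w.im := rfl
@[simp] theorem smul_im (z : ℂ) (w : Cx W) : (z • w).im = z.re • w.im + z.im • w.re := rfl

instance : Module ℂ (Cx W) where
  one_smul w := by ext <;> simp
  mul_smul z z' w := by ext <;> simp <;> module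
  smul_zero z := by ext <;> simp
  smul_add z a b := by ext <;> simp <;> module
  add_smul z z' a := by ext <;> simp <;> module
  zero_smul a := by ext <;> simp

/-- The complex-linear extension of a real linear map. -/
def map (f : W →ₗ[ℝ] W') : Cx W →ₗ[ℂ] Cx W' where
  toFun w := mk (f w.re) (f w.im)
  map_add' a b := by ext <;> simp
  map_smul' z a := by ext <;> simp

@[simp] theorem map_re (f : W →ₗ[ℝ] W') (w : Cx W) : (map f w).re = f w.re := rfl
@[simp] theorem map_im (f : W →ₗ[ℝ] W') (w : Cx W) : (map f w).im = f w.im := rfl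

end Cx

/-! ### Smooth functions, vector fields, one-forms and sections -/

section Manifold

variable (E : Type*) [NormedAddCommGroup E] [NormedSpace ℝ E]
variable {M : Type*} [TopologicalSpace M] [ChartedSpace E M]

/-- The tangent space `T_x M`. -/
abbrev Tan (x : M) : Type _ := TangentSpace 𝓘(ℝ, E) x

/-- The cotangent space `T*_x M`. -/
abbrev Cot (x : M) : Type _ := Tan E x →L[ℝ] ℝ

/-- The fibre `T_x M ⊕ T*_x M` of the generalized tangent bundle. -/
abbrev GTan (x : M) : Type _ := Tan E x × Cot E x

variable (M)

/-- The algebra `C^∞(M, ℝ)`. -/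
def RFun : Subalgebra ℝ (M → ℝ) where
  carrier := {f | ContMDiff 𝓘(ℝ, E) 𝓘(ℝ, ℝ) ∞ f}
  mul_mem' hf hg := ContMDiff.mul hf hg
  add_mem' hf hg := ContMDiff.add hf hg
  algebraMap_mem' _ := contMDiff_const

/-- The algebra `C^∞(M, ℂ)` of complex-valued functions that are smooth in the real sense. -/
def CFun : Subalgebra ℂ (M → ℂ) where
  carrier := {f | ContMDiff 𝓘(ℝ, E) 𝓘(ℝ, ℂ) ∞ f}
  mul_mem' hf hg := contDiff_mul.comp_contMDiff (ContMDiff.prodMk_space hf hg)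
  add_mem' hf hg := ContMDiff.add hf hg
  algebraMap_mem' _ := contMDiff_const

variable {E M} in
theorem CFun.re_mem {f : M → ℂ} (hf : f ∈ CFun E M) : (fun x => (f x).re) ∈ RFun E M :=
  Complex.reCLM.contDiff.comp_contMDiff hf

variable {E M} in
theorem CFun.im_mem {f : M → ℂ} (hf : f ∈ CFun E M) : (fun x => (f x).im) ∈ RFun E M :=
  Complex.imCLM.contDiff.comp_contMDiff hf

instance {W : M → Type*} [∀ x, AddCommGroup (W x)] [∀ x, Module ℂ (W x)]
    (S : Submodule (CFun E M) (Π x, W x)) : SMul (CFun E M) S :=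
  Module.toDistribMulAction.toSMul

variable [IsManifold 𝓘(ℝ, E) ∞ M]

/-- Smooth vector fields. -/
def vectorFields : Submodule (RFun E M) (Π x : M, Tan E x) where
  carrier := {X | ContMDiff 𝓘(ℝ, E) (𝓘(ℝ, E).prod 𝓘(ℝ, E)) ∞
    (fun x => (⟨x, X x⟩ : TotalSpace E (fun x : M => Tan E x)))}
  add_mem' hX hY := ContMDiff.add_section hX hY
  zero_mem' := contMDiff_zeroSection ℝ _
  smul_mem' f _ hX := ContMDiff.smul_section f.2 hX

/-- Smooth one-forms, as smooth sections of the bundle `Hom(TM, ℝ)`. -/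
def oneForms : Submodule (RFun E M) (Π x : M, Cot E x) where
  carrier := {ξ | ContMDiff 𝓘(ℝ, E) (𝓘(ℝ, E).prod 𝓘(ℝ, E →L[ℝ] ℝ)) ∞
    (fun x => (⟨x, ξ x⟩ : TotalSpace (E →L[ℝ] ℝ) (fun x : M => Tan E x →L[ℝ] Trivial M ℝ x)))}
  add_mem' hX hY := ContMDiff.add_section hX hY
  zero_mem' := contMDiff_zeroSection ℝ _
  smul_mem' f _ hX := ContMDiff.smul_section f.2 hX

/-- Smooth sections of the generalized tangent bundle `TM ⊕ T*M`. -/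
def genFields : Submodule (RFun E M) (Π x : M, GTan E x) where
  carrier := {u | (fun x => (u x).1) ∈ vectorFields E M ∧ (fun x => (u x).2) ∈ oneForms E M}
  add_mem' hu hv := ⟨add_mem hu.1 hv.1, add_mem hu.2 hv.2⟩
  zero_mem' := ⟨zero_mem _, zero_mem _⟩
  smul_mem' f _ hu := ⟨Submodule.smul_mem _ f hu.1, Submodule.smul_mem _ f hu.2⟩

variable {E M} in
/-- Smooth sections of the complexification of a real bundle, given the smooth sections of the real
bundle: real and imaginary part have to be smooth. -/
def cxSections {W : M → Type*} [∀ x, AddCommGroup (W x)] [∀ x, Module ℝ (W x)]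
    (S : Submodule (RFun E M) (Π x, W x)) : Submodule (CFun E M) (Π x, Cx (W x)) where
  carrier := {s | (fun x => (s x).re) ∈ S ∧ (fun x => (s x).im) ∈ S}
  add_mem' hu hv := ⟨add_mem hu.1 hv.1, add_mem hu.2 hv.2⟩
  zero_mem' := ⟨zero_mem _, zero_mem _⟩
  smul_mem' f _ hs :=
    ⟨sub_mem (S.smul_mem ⟨_, CFun.re_mem f.2⟩ hs.1) (S.smul_mem ⟨_, CFun.im_mem f.2⟩ hs.2),
     add_mem (S.smul_mem ⟨_, CFun.re_mem f.2⟩ hs.2) (S.smul_mem ⟨_, CFun.im_mem f.2⟩ hs.1)⟩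

variable {E M} in
/-- The sections in `S` with values in the sub-bundle with fibres `A x`. -/
def sectionsIn {W : M → Type*} [∀ x, AddCommGroup (W x)] [∀ x, Module ℂ (W x)]
    (S : Submodule (CFun E M) (Π x, W x)) (A : ∀ x, Submodule ℂ (W x)) :
    Submodule (CFun E M) (Π x, W x) where
  carrier := {s | s ∈ S ∧ ∀ x, s x ∈ A x}
  add_mem' hu hv := ⟨add_mem hu.1 hv.1, fun x => add_mem (hu.2 x) (hv.2 x)⟩
  zero_mem' := ⟨zero_mem _, fun _ => zero_mem _⟩
  smul_mem' f _ hs := ⟨S.smul_mem f hs.1, fun x => (A x).smul_mem _ (hs.2 x)⟩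

end Manifold

/-! ### The Courant-Dorfman bracket -/

section Courant

variable {E : Type*} [NormedAddCommGroup E] [NormedSpace ℝ E]
variable {M : Type*} [TopologicalSpace M] [ChartedSpace E M] [IsManifold 𝓘(ℝ, E) ∞ M]

theorem vectorFields.mdiff {X : Π x : M, Tan E x} (hX : X ∈ vectorFields E M) (x : M) :
    MDiffAt (fun x => (⟨x, X x⟩ : TotalSpace E (fun x : M => Tan E x))) x :=
  (ContMDiff.contMDiffAt hX).mdifferentiableAt (by simp)

theorem oneForms.mdiff {η : Π x : M, Cot E x} (hη : η ∈ oneForms E M) (x : M)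
    {Z : Π x : M, Tan E x}
    (hZ : MDiffAt (fun x => (⟨x, Z x⟩ : TotalSpace E (fun x : M => Tan E x))) x) :
    MDiffAt (fun y => (η y (Z y) : ℝ)) x := by
  have h : MDifferentiableAt 𝓘(ℝ, E) (𝓘(ℝ, E).prod 𝓘(ℝ, E →L[ℝ] ℝ))
    (fun x => (⟨x, η x⟩ : TotalSpace (E →L[ℝ] ℝ) (fun x : M => Tan E x →L[ℝ] Trivial M ℝ x))) x :=
    (ContMDiff.contMDiffAt hη).mdifferentiableAt (by simp)
  have := MDifferentiableAt.clm_bundle_apply h hZ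
  exact (mdifferentiableAt_totalSpace _ _).1 this |>.2

/-- The derivative `X f` of a function `f` along a vector field `X`. -/
def dir {F : Type*} [NormedAddCommGroup F] [NormedSpace ℝ F] (X : Π x : M, Tan E x) (f : M → F)
    (x : M) : F := mvfderiv 𝓘(ℝ, E) f x (X x)

/-- The Lie bracket of vector fields. -/
def lie (X Y : Π x : M, Tan E x) : Π x : M, Tan E x := VectorField.mlieBracket 𝓘(ℝ, E) X Y

variable (E M) in
/-- Smooth closed three-forms. Smoothness is tested on smooth vector fields, and the exterior
derivative is given by the invariant formula. -/
structure ClosedThreeForm where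
  /-- The underlying alternating form on each tangent space. -/
  toFun : ∀ x : M, Tan E x [⋀^Fin 3]→L[ℝ] ℝ
  smooth : ∀ X Y Z : vectorFields E M, (fun x => toFun x ![X.1 x, Y.1 x, Z.1 x]) ∈ RFun E M
  closed : ∀ (X Y Z W : vectorFields E M) (x : M),
    dir X.1 (fun y => toFun y ![Y.1 y, Z.1 y, W.1 y]) x
      - dir Y.1 (fun y => toFun y ![X.1 y, Z.1 y, W.1 y]) x
      + dir Z.1 (fun y => toFun y ![X.1 y, Y.1 y, W.1 y]) x
      - dir W.1 (fun y => toFun y ![X.1 y, Y.1 y, Z.1 y]) x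
      - toFun x ![lie X.1 Y.1 x, Z.1 x, W.1 x]
      + toFun x ![lie X.1 Z.1 x, Y.1 x, W.1 x]
      - toFun x ![lie X.1 W.1 x, Y.1 x, Z.1 x]
      - toFun x ![lie Y.1 Z.1 x, X.1 x, W.1 x]
      + toFun x ![lie Y.1 W.1 x, X.1 x, Z.1 x]
      - toFun x ![lie Z.1 W.1 x, X.1 x, Y.1 x] = 0

/-- The contraction `ι_X ι_Y γ = γ(Y, X, ·)`. -/
def ClosedThreeForm.contract (γ : ClosedThreeForm E M) {x : M} (X Y : Tan E x) : Cot E x :=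
  (γ.toFun x).toContinuousMultilinearMap.toContinuousLinearMap ![Y, X, 0] 2

theorem ClosedThreeForm.contract_apply (γ : ClosedThreeForm E M) {x : M} (X Y Z : Tan E x) :
    γ.contract X Y Z = γ.toFun x ![Y, X, Z] := by
  have : Function.update ![Y, X, 0] 2 Z = ![Y, X, Z] := by
    ext i; fin_cases i <;> rfl
  simp [contract, this]

variable [FiniteDimensional ℝ E]

theorem lieForm_tensorial (X : Π x : M, Tan E x) (η : oneForms E M) (x : M) :
    TensorialAt 𝓘(ℝ, E) E (fun Z : Π x : M, Tan E x =>
      dir X (fun y => η.1 y (Z y)) x - η.1 x (lie X Z x)) x where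
  smul := by
    intro f σ hf hσ
    have h1 := oneForms.mdiff η.2 x hσ
    have h2 : (fun y => η.1 y ((f • σ) y)) = f * (fun y => η.1 y (σ y)) := by
      ext y; simp
    simp only [dir, lie, h2, mvfderiv_mul hf h1, VectorField.mlieBracket_smul_right hf hσ]
    simp
    ring
  add := by
    intro σ σ' hσ hσ'
    have h1 := oneForms.mdiff η.2 x hσ
    have h1' := oneForms.mdiff η.2 x hσ'
    have h2 : (fun y => η.1 y ((σ + σ') y)) =
      (fun y => η.1 y (σ y)) + (fun y => η.1 y (σ' y)) := by
      ext y; simp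
    simp only [dir, lie, h2, mvfderiv_add h1 h1', VectorField.mlieBracket_add_right hσ hσ']
    simp
    ring

/-- The Lie derivative `L_X η`, with `(L_X η)(Z) = X (η(Z)) - η([X, Z])`. -/
def lieForm (X : Π x : M, Tan E x) (η : oneForms E M) (x : M) : Cot E x :=
  TensorialAt.mkHom (fun Z : Π x : M, Tan E x =>
    dir X (fun y => η.1 y (Z y)) x - η.1 x (lie X Z x)) x (lieForm_tensorial X η x)

theorem contractD_tensorial (Y : vectorFields E M) (ξ : oneForms E M) (x : M) :
    TensorialAt 𝓘(ℝ, E) E (fun Z : Π x : M, Tan E x =>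
      dir Y.1 (fun y => ξ.1 y (Z y)) x - dir Z (fun y => ξ.1 y (Y.1 y)) x
        - ξ.1 x (lie Y.1 Z x)) x where
  smul := by
    intro f σ hf hσ
    have h := (lieForm_tensorial Y.1 ξ x).smul hf hσ
    simp only [smul_eq_mul] at h ⊢
    have h' : dir (f • σ) (fun y => ξ.1 y (Y.1 y)) x = f x * dir σ (fun y => ξ.1 y (Y.1 y)) x := by
      simp [dir]
    rw [h']
    linarith
  add := by
    intro σ σ' hσ hσ'
    have h := (lieForm_tensorial Y.1 ξ x).add hσ hσ'
    simp only [dir, Pi.add_apply, map_add] at h ⊢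
    linarith

/-- The contraction `ι_Y dξ`, with `dξ(Y, Z) = Y (ξ(Z)) - Z (ξ(Y)) - ξ([Y, Z])`. -/
def contractD (Y : vectorFields E M) (ξ : oneForms E M) (x : M) : Cot E x :=
  TensorialAt.mkHom (fun Z : Π x : M, Tan E x =>
      dir Y.1 (fun y => ξ.1 y (Z y)) x - dir Z (fun y => ξ.1 y (Y.1 y)) x
        - ξ.1 x (lie Y.1 Z x)) x (contractD_tensorial Y ξ x)

theorem lieForm_apply (X : Π x : M, Tan E x) (η : oneForms E M) {Z : Π x : M, Tan E x}
    (hZ : Z ∈ vectorFields E M) (x : M) :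
    (lieForm X η x (Z x) : ℝ) =
      dir X (fun y => η.1 y (Z y)) x - η.1 x (lie X Z x) :=
  TensorialAt.mkHom_apply (lieForm_tensorial X η x) (vectorFields.mdiff hZ x)

theorem contractD_apply (Y : vectorFields E M) (ξ : oneForms E M) {Z : Π x : M, Tan E x}
    (hZ : Z ∈ vectorFields E M) (x : M) :
    (contractD Y ξ x (Z x) : ℝ) =
      dir Y.1 (fun y => ξ.1 y (Z y)) x - dir Z (fun y => ξ.1 y (Y.1 y)) x
        - ξ.1 x (lie Y.1 Z x) :=
  TensorialAt.mkHom_apply (contractD_tensorial Y ξ x) (vectorFields.mdiff hZ x)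

/-- The Courant-Dorfman bracket
`(X + ξ) * (Y + η) = [X, Y] + L_X η - ι_Y dξ + ι_X ι_Y γ` of smooth sections of `TM ⊕ T*M`. -/
def dorfman (γ : ClosedThreeForm E M) (u v : genFields E M) (x : M) : GTan E x :=
  (lie (fun y => (u.1 y).1) (fun y => (v.1 y).1) x,
    lieForm (fun y => (u.1 y).1) ⟨_, v.2.2⟩ x - contractD ⟨_, v.2.1⟩ ⟨_, u.2.2⟩ x
      + γ.contract (u.1 x).1 (v.1 x).1)

variable (E M) in
/-- Smooth sections of `(TM ⊕ T*M) ⊗ ℂ`. -/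
abbrev cxGenFields : Submodule (CFun E M) (Π x : M, Cx (GTan E x)) := cxSections (genFields E M)

variable (E M) in
/-- Smooth complex vector fields, that is, sections of `TM ⊗ ℂ`. -/
abbrev cxVectorFields : Submodule (CFun E M) (Π x : M, Cx (Tan E x)) :=
  cxSections (vectorFields E M)

/-- The complex-bilinear extension of the Courant-Dorfman bracket. -/
def cxDorfman (γ : ClosedThreeForm E M) (s t : cxGenFields E M) (x : M) : Cx (GTan E x) :=
  Cx.mk
    (dorfman γ ⟨_, s.2.1⟩ ⟨_, t.2.1⟩ x - dorfman γ ⟨_, s.2.2⟩ ⟨_, t.2.2⟩ x)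
    (dorfman γ ⟨_, s.2.1⟩ ⟨_, t.2.2⟩ x + dorfman γ ⟨_, s.2.2⟩ ⟨_, t.2.1⟩ x)

/-- The complex-bilinear extension of the Lie bracket of vector fields. -/
def cxLie (X Y : Π x : M, Cx (Tan E x)) (x : M) : Cx (Tan E x) :=
  Cx.mk
    (lie (fun y => (X y).re) (fun y => (Y y).re) x - lie (fun y => (X y).im) (fun y => (Y y).im) x)
    (lie (fun y => (X y).re) (fun y => (Y y).im) x + lie (fun y => (X y).im) (fun y => (Y y).re) x)

/-- The derivative of a complex function along a complex vector field. -/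
def cxDir (X : Π x : M, Cx (Tan E x)) (f : M → ℂ) (x : M) : ℂ :=
  dir (fun y => (X y).re) f x + Complex.I * dir (fun y => (X y).im) f x

variable (E) in
/-- The complexified anchor, the projection `a : (TM ⊕ T*M) ⊗ ℂ → TM ⊗ ℂ`. -/
def anchor (x : M) : Cx (GTan E x) →ₗ[ℂ] Cx (Tan E x) := Cx.map (LinearMap.fst ℝ (Tan E x) (Cot E x))

end Courant

/-! ### Generalized complex and generalized Kähler structures -/

section Generalized

variable {E : Type*} [NormedAddCommGroup E] [NormedSpace ℝ E]
variable {M : Type*} [TopologicalSpace M] [ChartedSpace E M]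

/-- The natural pairing `⟨X + ξ, Y + η⟩ = (η(X) + ξ(Y)) / 2`. -/
def pairing {x : M} (u v : GTan E x) : ℝ := (v.2 u.1 + u.2 v.1) / 2

variable [IsManifold 𝓘(ℝ, E) ∞ M]

variable (E M) in
/-- Generalized almost complex structures: smooth orthogonal bundle endomorphisms of `TM ⊕ T*M`
with square `-1`. -/
structure GenAlmostComplex where
  /-- The endomorphism of each fibre. -/
  toFun : ∀ x : M, GTan E x →ₗ[ℝ] GTan E x
  smooth : ∀ u ∈ genFields E M, (fun x => toFun x (u x)) ∈ genFields E M
  sq : ∀ x u, toFun x (toFun x u) = -u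
  orthogonal : ∀ x u v, pairing (toFun x u) (toFun x v) = pairing u v

/-- The fibre at `x` of the eigenbundle of `J` in `(TM ⊕ T*M) ⊗ ℂ` with eigenvalue `c`. -/
def GenAlmostComplex.eig (J : GenAlmostComplex E M) (c : ℂ) (x : M) :
    Submodule ℂ (Cx (GTan E x)) :=
  End.eigenspace (Cx.map (J.toFun x)) c

theorem cov_neg (cov : CovariantDerivative 𝓘(ℝ, E) E (fun x : M => TangentSpace 𝓘(ℝ, E) x))
    {Y : Π x : M, Tan E x} (hY : Y ∈ vectorFields E M) (x : M) :
    cov (-Y) x = -cov Y x := by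
  have := cov.isCovariantDerivativeOnUniv.smul_const (-1) (vectorFields.mdiff hY x)
  simpa using this

variable [FiniteDimensional ℝ E]

/-- Integrability: the `i`-eigenbundle is involutive. -/
def GenAlmostComplex.IsIntegrable (γ : ClosedThreeForm E M) (J : GenAlmostComplex E M) : Prop :=
  ∀ s t : cxGenFields E M, (∀ x, s.1 x ∈ J.eig Complex.I x) → (∀ x, t.1 x ∈ J.eig Complex.I x) →
    ∀ x, cxDorfman γ s t x ∈ J.eig Complex.I x

/-- Generalized Kähler structures `(J, J')`. -/
structure GenKahler (γ : ClosedThreeForm E M) where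
  /-- The first generalized complex structure. -/
  J : GenAlmostComplex E M
  /-- The second generalized complex structure. -/
  J' : GenAlmostComplex E M
  integrable : J.IsIntegrable γ
  integrable' : J'.IsIntegrable γ
  comm : ∀ x u, J.toFun x (J'.toFun x u) = J'.toFun x (J.toFun x u)
  pos : ∀ x u, u ≠ 0 → 0 < pairing (-(J.toFun x (J'.toFun x u))) u

namespace GenKahler

variable {γ : ClosedThreeForm E M} (K : GenKahler γ)

/-- The generalized Kähler metric `G = -J J'` as an endomorphism. -/
def G (x : M) : End ℝ (GTan E x) := -(K.J.toFun x ∘ₗ K.J'.toFun x)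

/-- The eigenbundle `C_σ` of `G` with eigenvalue `σ`, for a sign `σ`. -/
def C (σ : ℤˣ) (x : M) : Submodule ℝ (GTan E x) := End.eigenspace (K.G x) ((σ : ℤ) : ℝ)

theorem G_G (x : M) (u : GTan E x) : K.G x (K.G x u) = u := by
  simp [G, K.comm, K.J.sq, K.J'.sq]

theorem proj_injective (σ : ℤˣ) (x : M) :
    Function.Injective (LinearMap.fst ℝ (Tan E x) (Cot E x) ∘ₗ (K.C σ x).subtype) := by
  rw [injective_iff_map_eq_zero]
  rintro ⟨⟨X, ξ⟩, hu⟩ h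
  have hX : X = 0 := h
  subst hX
  by_contra hne
  have h0 : ((0 : Tan E x), ξ) ≠ 0 := fun h => hne (Subtype.ext h)
  have hp := K.pos x _ h0
  have hG : -(K.J.toFun x (K.J'.toFun x (0, ξ))) = ((σ : ℤ) : ℝ) • ((0 : Tan E x), ξ) :=
    End.mem_eigenspace_iff.1 hu
  rw [hG] at hp
  simp [pairing] at hp

theorem proj_bijective (σ : ℤˣ) (x : M) :
    Function.Bijective (LinearMap.fst ℝ (Tan E x) (Cot E x) ∘ₗ (K.C σ x).subtype) := by
  have : FiniteDimensional ℝ (Tan E x) := inferInstanceAs (FiniteDimensional ℝ E)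
  have hdim : finrank ℝ (Cot E x) = finrank ℝ (Tan E x) := by
    have e : (E →L[ℝ] ℝ) ≃ₗ[ℝ] (E →ₗ[ℝ] ℝ) := LinearMap.toContinuousLinearMap.symm
    have h1 : finrank ℝ (E →L[ℝ] ℝ) = finrank ℝ E := by
      rw [e.finrank_eq]; exact Subspace.dual_finrank_eq
    exact h1
  have : FiniteDimensional ℝ (Cot E x) := inferInstanceAs (FiniteDimensional ℝ (E →L[ℝ] ℝ))
  have hle : ∀ τ : ℤˣ, finrank ℝ (K.C τ x) ≤ finrank ℝ (Tan E x) := fun τ =>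
    LinearMap.finrank_le_finrank_of_injective (K.proj_injective τ x)
  have hsup : K.C 1 x ⊔ K.C (-1) x = ⊤ := by
    rw [eq_top_iff]
    intro u _
    have : u = (2⁻¹ : ℝ) • (u + K.G x u) + (2⁻¹ : ℝ) • (u - K.G x u) := by module
    rw [this]
    refine Submodule.add_mem_sup (Submodule.smul_mem _ _ ?_) (Submodule.smul_mem _ _ ?_)
    · refine End.mem_eigenspace_iff.2 ?_
      rw [map_add, K.G_G]; simp [add_comm]
    · refine End.mem_eigenspace_iff.2 ?_
      rw [map_sub, K.G_G]; simp
  have hsum : finrank ℝ (Tan E x) + finrank ℝ (Tan E x) ≤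
      finrank ℝ (K.C 1 x) + finrank ℝ (K.C (-1) x) := by
    have h1 := Submodule.finrank_add_le_finrank_add_finrank (K.C 1 x) (K.C (-1) x)
    rw [hsup, finrank_top, finrank_prod, hdim] at h1
    exact h1
  have heq : finrank ℝ (K.C σ x) = finrank ℝ (Tan E x) := by
    have h1 := hle 1
    have h2 := hle (-1)
    rcases Int.units_eq_one_or σ with rfl | rfl <;> omega
  refine ⟨K.proj_injective σ x, LinearMap.range_eq_top.1 (Submodule.eq_top_of_finrank_eq ?_)⟩
  rw [LinearMap.finrank_range_of_inj (K.proj_injective σ x), heq]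

/-- The isomorphism `a_σ : C_σ → TM` given by the projection. -/
def aEquiv (σ : ℤˣ) (x : M) : K.C σ x ≃ₗ[ℝ] Tan E x :=
  LinearEquiv.ofBijective (LinearMap.fst ℝ (Tan E x) (Cot E x) ∘ₗ (K.C σ x).subtype)
    (K.proj_bijective σ x)

/-- The lift `a_σ⁻¹ : TM → C_σ ⊆ TM ⊕ T*M`. -/
def lift (σ : ℤˣ) (x : M) : Tan E x →ₗ[ℝ] GTan E x :=
  (K.C σ x).subtype ∘ₗ (K.aEquiv σ x).symm.toLinearMap

/-- The Riemannian metric `g(X, Y) = ⟨a_+⁻¹ X, a_+⁻¹ Y⟩`, which is also `-⟨a_-⁻¹ X, a_-⁻¹ Y⟩`. -/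
def metric (x : M) (X Y : Tan E x) : ℝ := pairing (K.lift 1 x X) (K.lift 1 x Y)

/-- The complex structures `I_σ = a ∘ J ∘ a_σ⁻¹` on `TM`. -/
def cplx (σ : ℤˣ) (x : M) : Tan E x →ₗ[ℝ] Tan E x :=
  LinearMap.fst ℝ (Tan E x) (Cot E x) ∘ₗ K.J.toFun x ∘ₗ K.lift σ x

/-- The anti-holomorphic tangent bundle of `I_σ`, the `-i`-eigenbundle in `TM ⊗ ℂ`. -/
def T01 (σ : ℤˣ) (x : M) : Submodule ℂ (Cx (Tan E x)) :=
  End.eigenspace (Cx.map (K.cplx σ x)) (-Complex.I)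

/-- Smooth sections of the anti-holomorphic tangent bundle of `I_σ`. -/
def secT01 (σ : ℤˣ) : Submodule (CFun E M) (Π x : M, Cx (Tan E x)) :=
  sectionsIn (cxVectorFields E M) (K.T01 σ)

/-- Smooth sections of `Lbar`, the `-i`-eigenbundle of `J` and complex conjugate of `L`. -/
def secLbar : Submodule (CFun E M) (Π x : M, Cx (GTan E x)) :=
  sectionsIn (cxGenFields E M) (K.J.eig (-Complex.I))

/-- The bundles `lbar_+ = Lbar ∩ Lbar'` and `lbar_- = Lbar ∩ L'`. -/
def lbar (σ : ℤˣ) (x : M) : Submodule ℂ (Cx (GTan E x)) :=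
  K.J.eig (-Complex.I) x ⊓ K.J'.eig (-(((σ : ℤ) : ℂ) * Complex.I)) x

end GenKahler

/-! ### Bismut connections -/

/-- `cov` is the Bismut connection of the Hermitian structure `(g, I)`: a smooth connection on `TM`
for which `g` and `I` are parallel and whose torsion is totally skew-symmetric. -/
structure IsBismut (g : ∀ x : M, Tan E x → Tan E x → ℝ) (I : ∀ x : M, Tan E x →ₗ[ℝ] Tan E x)
    (cov : CovariantDerivative 𝓘(ℝ, E) E (fun x : M => TangentSpace 𝓘(ℝ, E) x)) : Prop where
  smooth : CovariantDerivative.ContMDiffCovariantDerivative cov ∞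
  metric : ∀ (X Y Z : vectorFields E M) (x : M),
    dir X.1 (fun y => g y (Y.1 y) (Z.1 y)) x
      = g x (cov Y.1 x (X.1 x)) (Z.1 x) + g x (Y.1 x) (cov Z.1 x (X.1 x))
  complex : ∀ (X Y : vectorFields E M) (x : M),
    cov (fun y => I y (Y.1 y)) x (X.1 x) = I x (cov Y.1 x (X.1 x))
  skew : ∀ (x : M) (X Y Z : Tan E x), g x (cov.torsion x X Y) Z = -g x (cov.torsion x X Z) Y

namespace IsBismut

variable {g : ∀ x : M, Tan E x → Tan E x → ℝ} {I : ∀ x : M, Tan E x →ₗ[ℝ] Tan E x}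
  {cov : CovariantDerivative 𝓘(ℝ, E) E (fun x : M => TangentSpace 𝓘(ℝ, E) x)}

theorem mem_vectorFields (h : IsBismut g I cov) {X Y : Π x : M, Tan E x}
    (hX : X ∈ vectorFields E M) (hY : Y ∈ vectorFields E M) :
    (fun x => cov Y x (X x)) ∈ vectorFields E M := by
  have h1 := h.smooth.contMDiff.contMDiff (σ := Y) (ContMDiff.contMDiffOn hY)
  exact ContMDiff.clm_bundle_apply (contMDiffOn_univ.1 h1) hX

end IsBismut

/-- The complex-bilinear extension of a connection on `TM`, giving `∇_X Y` for complex vector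
fields `X` and `Y`. -/
def cxCov (cov : CovariantDerivative 𝓘(ℝ, E) E (fun x : M => TangentSpace 𝓘(ℝ, E) x))
    (X Y : Π x : M, Cx (Tan E x)) (x : M) : Cx (Tan E x) :=
  Cx.mk (cov (fun y => (Y y).re) x (X x).re - cov (fun y => (Y y).im) x (X x).im)
    (cov (fun y => (Y y).im) x (X x).re + cov (fun y => (Y y).re) x (X x).im)

/-- A Bismut connection preserves the smooth sections of the anti-holomorphic tangent bundle. -/
theorem GenKahler.cxCov_mem {γ : ClosedThreeForm E M} (K : GenKahler γ) {σ : ℤˣ}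
    {cov : CovariantDerivative 𝓘(ℝ, E) E (fun x : M => TangentSpace 𝓘(ℝ, E) x)}
    (h : IsBismut K.metric (K.cplx σ) cov) {X Y : Π x : M, Cx (Tan E x)}
    (hX : X ∈ cxVectorFields E M) (hY : Y ∈ K.secT01 σ) : cxCov cov X Y ∈ K.secT01 σ := by
  obtain ⟨hY, hY'⟩ := hY
  refine ⟨⟨sub_mem (h.mem_vectorFields hX.1 hY.1) (h.mem_vectorFields hX.2 hY.2),
    add_mem (h.mem_vectorFields hX.1 hY.2) (h.mem_vectorFields hX.2 hY.1)⟩, fun x => ?_⟩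
  have h1 : (fun y => K.cplx σ y (Y y).re) = fun y => (Y y).im := by
    ext1 y
    have := congrArg Cx.re (End.mem_eigenspace_iff.1 (hY' y))
    simpa using this
  have h2 : (fun y => K.cplx σ y (Y y).im) = -fun y => (Y y).re := by
    ext1 y
    have := congrArg Cx.im (End.mem_eigenspace_iff.1 (hY' y))
    simpa using this
  have a (Z : Π x : M, Tan E x) (hZ : Z ∈ vectorFields E M) :
      K.cplx σ x (cov (fun y => (Y y).re) x (Z x)) = cov (fun y => (Y y).im) x (Z x) := by
    rw [← h.complex ⟨Z, hZ⟩ ⟨_, hY.1⟩ x, h1]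
  have b (Z : Π x : M, Tan E x) (hZ : Z ∈ vectorFields E M) :
      K.cplx σ x (cov (fun y => (Y y).im) x (Z x)) = -cov (fun y => (Y y).re) x (Z x) := by
    rw [← h.complex ⟨Z, hZ⟩ ⟨_, hY.2⟩ x, h2, cov_neg cov hY.1]; rfl
  refine End.mem_eigenspace_iff.2 ?_
  have a1 := a _ hX.1
  have a2 := a _ hX.2
  have b1 := b _ hX.1
  have b2 := b _ hX.2
  ext
  · simp [cxCov, a1, b2]
  · simp [cxCov, b1, a2, sub_eq_add_neg, add_comm]

end Generalized

/-! ### Partial connections on a complex vector bundle -/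

section Bundles

variable {E : Type*} [NormedAddCommGroup E] [NormedSpace ℝ E]
variable {M : Type*} [TopologicalSpace M] [ChartedSpace E M]
variable (F : Type*) [NormedAddCommGroup F] [NormedSpace ℂ F]
variable (V : M → Type*) [TopologicalSpace (TotalSpace F V)] [∀ x, AddCommGroup (V x)]
  [∀ x, Module ℂ (V x)] [∀ x, TopologicalSpace (V x)] [FiberBundle F V] [VectorBundle ℂ F V]
  [VectorBundle ℝ F V]

variable (E) in
/-- The module `C^∞(V)` of smooth sections of a complex vector bundle. -/
def sections : Submodule (CFun E M) (Π x, V x) where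
  carrier := {v | ContMDiff 𝓘(ℝ, E) (𝓘(ℝ, E).prod 𝓘(ℝ, F)) ∞
    (fun x => (⟨x, v x⟩ : TotalSpace F V))}
  add_mem' hX hY := ContMDiff.add_section hX hY
  zero_mem' := contMDiff_zeroSection ℝ _
  smul_mem' := by
    rintro ⟨f, hf⟩ v hv x₀
    have hv0 := hv x₀
    rw [contMDiffAt_section] at hv0 ⊢
    have hf0 : ContMDiffAt 𝓘(ℝ, E) 𝓘(ℝ, ℂ) ∞ f x₀ := hf x₀
    set e := trivializationAt F V x₀
    have hb : IsBoundedBilinearMap ℝ (fun p : ℂ × F => p.1 • p.2) := isBoundedBilinearMap_smul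
    refine (hb.contDiff.contDiffAt.comp_contMDiffAt
      (hf0.prodMk_space hv0)).congr_of_eventuallyEq ?_
    filter_upwards [e.open_baseSet.mem_nhds (FiberBundle.mem_baseSet_trivializationAt' x₀)]
      with x hx
    exact (e.linear ℂ hx).2 _ _

/-- A partial connection on `V` along a module `A` of sections of a bundle with anchor `ρ` to
`TM ⊗ ℂ`: a derivation `D : C^∞(V) → C^∞(V ⊗ A*)`, written as `D_s v` for a section `s` of `A`. It is
`C^∞(M, ℂ)`-linear in `s`, additive in `v` and satisfies the Leibniz rule
`D_s (f v) = f D_s v + (ρ(s) f) v`. -/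
@[ext]
structure PartialConnection [IsManifold 𝓘(ℝ, E) ∞ M] {W : M → Type*} [∀ x, AddCommGroup (W x)]
    [∀ x, Module ℂ (W x)] (F : Type*) [NormedAddCommGroup F] [NormedSpace ℂ F] (V : M → Type*)
    [TopologicalSpace (TotalSpace F V)] [∀ x, AddCommGroup (V x)]
    [∀ x, Module ℂ (V x)] [∀ x, TopologicalSpace (V x)] [FiberBundle F V] [VectorBundle ℂ F V]
    [VectorBundle ℝ F V] (A : Submodule (CFun E M) (Π x, W x))
    (ρ : ∀ x, W x →ₗ[ℂ] Cx (Tan E x)) where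
  /-- The map `s ↦ (v ↦ D_s v)`. -/
  toFun : A →ₗ[CFun E M] (sections E F V →+ sections E F V)
  leibniz : ∀ (s : A) (f : CFun E M) (v : sections E F V) (x : M),
    (toFun s (f • v)).1 x
      = f.1 x • (toFun s v).1 x + cxDir (fun y => ρ y (s.1 y)) f.1 x • v.1 x

variable {F V}
variable [IsManifold 𝓘(ℝ, E) ∞ M]

/-- Flatness of a partial connection, `D_s D_t v - D_t D_s v = D_[s,t] v`, with respect to a bracket
`br s t` of sections of `A`. The modules `A` below are closed under their brackets, so that for all
`s` and `t` there is a (unique) section `r` of `A` which equals `br s t`. -/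
def PartialConnection.IsFlat {W : M → Type*} [∀ x, AddCommGroup (W x)] [∀ x, Module ℂ (W x)]
    {A : Submodule (CFun E M) (Π x, W x)} {ρ : ∀ x, W x →ₗ[ℂ] Cx (Tan E x)}
    (D : PartialConnection F V A ρ) (br : A → A → Π x, W x) : Prop :=
  ∀ s t r : A, r.1 = br s t → ∀ v : sections E F V,
    D.toFun s (D.toFun t v) - D.toFun t (D.toFun s v) = D.toFun r v

variable [FiniteDimensional ℝ E] {γ : ClosedThreeForm E M}

variable (F V) in
/-- Connections along `Lbar`, that is, derivations `D : C^∞(V) → C^∞(V ⊗ Lbar*)`. -/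
abbrev LbarConnection (K : GenKahler γ) : Type _ := PartialConnection F V K.secLbar (anchor E)

variable (F V) in
/-- `(0,1)`-connections with respect to `I_σ`, that is, derivations
`∂bar_σ : C^∞(V) → C^∞(V ⊗ T^{0,1}_σ M)`. -/
abbrev DolbeaultOperator (K : GenKahler γ) (σ : ℤˣ) : Type _ :=
  PartialConnection F V (K.secT01 σ) (fun _ => LinearMap.id)

variable (F V) in
/-- `J`-holomorphic structures on `V`: flat connections along `Lbar`. -/
structure GenHolStructure (K : GenKahler γ) where
  /-- The derivation. -/
  D : LbarConnection F V K
  flat : D.IsFlat (fun s t => cxDorfman γ ⟨s.1, s.2.1⟩ ⟨t.1, t.2.1⟩)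

variable (F V) in
/-- Holomorphic structures on `V` with respect to `I_σ`: operators `∂bar_σ` with
`∂bar_σ ^ 2 = 0`. -/
structure HolStructure (K : GenKahler γ) (σ : ℤˣ) where
  /-- The derivation. -/
  D : DolbeaultOperator F V K σ
  flat : D.IsFlat (fun X Y => cxLie X.1 Y.1)

section Commutation

variable {K : GenKahler γ} {σ τ : ℤˣ}
  {cov : CovariantDerivative 𝓘(ℝ, E) E (fun x : M => TangentSpace 𝓘(ℝ, E) x)}

variable (F V) in
/-- Smooth sections of `V ⊗ T^{0,1}_σ M`, as `C^∞(M, ℂ)`-linear maps from sections of the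
anti-holomorphic tangent bundle of `I_σ` to sections of `V`. -/
abbrev OneFormsWithValues (K : GenKahler γ) (σ : ℤˣ) : Type _ :=
  K.secT01 σ →ₗ[CFun E M] sections E F V

/-- The section `∂bar_σ v` of `V ⊗ T^{0,1}_σ M`. -/
def DolbeaultOperator.apply (d : DolbeaultOperator F V K σ) (v : sections E F V) :
    OneFormsWithValues F V K σ where
  toFun Y := d.toFun Y v
  map_add' Y Z := by rw [map_add]; rfl
  map_smul' f Y := by rw [map_smul]; rfl

/-- The covariant derivative `∇_X Y` of a section `Y` of the anti-holomorphic tangent bundle of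
`I_σ` with respect to the Bismut connection of `(g, I_σ)`, along a section `X` of the
anti-holomorphic tangent bundle of `I_τ`. -/
def bismutAlong (h : IsBismut K.metric (K.cplx σ) cov) (X : K.secT01 τ) (Y : K.secT01 σ) :
    K.secT01 σ :=
  ⟨cxCov cov X.1 Y.1, K.cxCov_mem h X.2.1 Y.2⟩

/-- For `τ = -σ`, this is the component
`δbar_σ : C^∞(T^{0,1}_σ M) → C^∞(T^{0,1}_{-σ} M ⊗ T^{0,1}_σ M)` of the Bismut connection on forms:
`(δbar_σ α)(X, Y) = X (α(Y)) - α(∇_X Y)`. A form in `C^∞(T^{0,1}_σ M)` is regarded as a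
`C^∞(M, ℂ)`-linear functional on sections of the anti-holomorphic tangent bundle of `I_σ`. -/
def deltaBar (h : IsBismut K.metric (K.cplx σ) cov) (α : K.secT01 σ →ₗ[CFun E M] CFun E M)
    (X : K.secT01 τ) (Y : K.secT01 σ) (x : M) : ℂ :=
  cxDir X.1 (α Y).1 x - (α (bismutAlong h X Y)).1 x

/-- For `τ = -σ`, this is the extension
`C^∞(V ⊗ T^{0,1}_σ M) → C^∞(V ⊗ T^{0,1}_{-σ} M ⊗ T^{0,1}_σ M)` of an operator `∂bar_{-σ}` on `V` by
means of `δbar_σ`, that is, the tensor product connection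
`A ↦ ((X, Y) ↦ ∂bar_{-σ, X} (A(Y)) - A(∇_X Y))`. -/
def extend (h : IsBismut K.metric (K.cplx σ) cov) (d : DolbeaultOperator F V K τ)
    (A : OneFormsWithValues F V K σ) (X : K.secT01 τ) (Y : K.secT01 σ) : sections E F V :=
  d.toFun X (A Y) - A (bismutAlong h X Y)

/-- On decomposable sections the extension is given by
`∂bar (v ⊗ α) = ∂bar v ⊗ α + v ⊗ δbar α`. -/
theorem extend_tensor (h : IsBismut K.metric (K.cplx σ) cov) (d : DolbeaultOperator F V K τ)
    (v : sections E F V) (α : K.secT01 σ →ₗ[CFun E M] CFun E M) (A : OneFormsWithValues F V K σ)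
    (hA : ∀ Y, A Y = α Y • v) (X : K.secT01 τ) (Y : K.secT01 σ) (x : M) :
    (extend h d A X Y).1 x = (α Y).1 x • (d.toFun X v).1 x + deltaBar h α X Y x • v.1 x := by
  have h1 : (extend h d A X Y).1 x =
      (d.toFun X (A Y)).1 x - (A (bismutAlong h X Y)).1 x := rfl
  have h2 : ((α (bismutAlong h X Y)) • v).1 x = (α (bismutAlong h X Y)).1 x • v.1 x := rfl
  rw [h1, hA, hA, d.leibniz, h2, deltaBar, sub_smul]
  simp only [LinearMap.id_apply]
  abel

/-- The identification of `V ⊗ T^{0,1}_- M ⊗ T^{0,1}_+ M` with `V ⊗ T^{0,1}_+ M ⊗ T^{0,1}_- M` given by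
`β ⊗ α ↦ -α ⊗ β`. -/
def swapNeg (B : K.secT01 (-1) → K.secT01 1 → sections E F V) (X : K.secT01 1)
    (Y : K.secT01 (-1)) : sections E F V := -B Y X

variable {covp covm : CovariantDerivative 𝓘(ℝ, E) E (fun x : M => TangentSpace 𝓘(ℝ, E) x)}

/-- The commutator `[∂bar_+, ∂bar_-] v = ∂bar_+ ∂bar_- v + ∂bar_- ∂bar_+ v`, a section of
`V ⊗ T^{0,1}_+ M ⊗ T^{0,1}_- M`, given by its values on `(X, Y)`. -/
def commutator (hp : IsBismut K.metric (K.cplx 1) covp) (hm : IsBismut K.metric (K.cplx (-1)) covm)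
    (dp : DolbeaultOperator F V K 1) (dm : DolbeaultOperator F V K (-1)) (v : sections E F V)
    (X : K.secT01 1) (Y : K.secT01 (-1)) : sections E F V :=
  extend hm dp (dm.apply v) X Y + swapNeg (extend hp dm (dp.apply v)) X Y

variable (V) in
/-- Pairs of holomorphic structures with respect to `I_+` and `I_-` that satisfy the commutation
relation `[∂bar_+, ∂bar_-] = 0`. -/
structure CommutingHolStructure (F : Type*) [NormedAddCommGroup F] [NormedSpace ℂ F]
    [TopologicalSpace (TotalSpace F V)] [FiberBundle F V] [VectorBundle ℂ F V]
    [VectorBundle ℝ F V] (hp : IsBismut K.metric (K.cplx 1) covp)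
    (hm : IsBismut K.metric (K.cplx (-1)) covm) where
  /-- The holomorphic structure with respect to `I_+`. -/
  plus : HolStructure F V K 1
  /-- The holomorphic structure with respect to `I_-`. -/
  minus : HolStructure F V K (-1)
  commute : ∀ v X Y, commutator hp hm plus.D minus.D v X Y = 0

/-- The relation between a connection `D` along `Lbar` and the operator `∂bar_σ` it induces:
`∂bar_{σ, X} v = D_s v` whenever `s` is a section of `lbar_σ` and `X = a(s)`. -/
def Induces (D : LbarConnection F V K) (d : DolbeaultOperator F V K σ) : Prop :=
  ∀ (s : K.secLbar) (X : K.secT01 σ), (∀ x, s.1 x ∈ K.lbar σ x) →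
    (∀ x, X.1 x = anchor E x (s.1 x)) → ∀ v, d.toFun X v = D.toFun s v

end Commutation

end Bundles

end GK
end

/-! Since `Lbar` is the direct sum of `lbar_+` and `lbar_-`, and the anchor identifies `lbar_σ` with
the anti-holomorphic tangent bundle of `I_σ`, a derivation along `Lbar` is the same thing as a pair
of derivations, one along each summand. The content is that flatness of the former matches flatness
of both members of the pair together with the commutation relation. As the bracket is biadditive and
every section of `Lbar` is a sum of two lifts, flatness only has to be understood on pairs of lifts,
and everything reduces to two bracket formulas.

Same sign (`bracket_cxLift`): integrability of both `J` and `J'` forces the bracket of two sections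
of `lbar_σ` to have real and imaginary parts in `C_σ`. Such an element is determined by its anchor,
which is the Lie bracket. Flatness on these pairs is the equation `∂bar_σ ^ 2 = 0`.

Mixed sign (`bracket_cxLift_mixed`): for `X` in the `+` and `Y` in the `-` bundle, the bracket of
the lifts is the lift of `∇^-_X Y` minus the lift of `∇^+_Y X`. Flatness on these pairs is, term by
term, the vanishing of the commutator (`commutator_eq`).

The mixed formula rests on the description of the Bismut connection as `∇^σ_X Y = a (a_{-σ}⁻¹ X *
a_σ⁻¹ Y)_σ`. The right-hand side is compatible with `g` and `I_σ` and satisfies the skew-torsion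
identity, by the derivation property of the Courant-Dorfman bracket and the two Nijenhuis
identities; these properties force it to agree with any Bismut connection (`genBismut_eq`).

The lifts `a_σ⁻¹` are defined fibrewise, so their smoothness has to be established before brackets
of lifts make sense (`lift_genFields`). -/

noncomputable section

namespace GK

/-! ### Global sections and smoothness of inverse bundle maps. -/

section SmoothBundles

variable {E : Type*} [NormedAddCommGroup E] [NormedSpace ℝ E] [FiniteDimensional ℝ E]
  {M : Type*} [TopologicalSpace M] [T2Space M] [ChartedSpace E M] [IsManifold 𝓘(ℝ, E) ∞ M]
  {F₁ : Type*} [NormedAddCommGroup F₁] [NormedSpace ℝ F₁]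
  {V₁ : M → Type*} [TopologicalSpace (TotalSpace F₁ V₁)] [∀ x, AddCommGroup (V₁ x)]
  [∀ x, Module ℝ (V₁ x)] [∀ x, TopologicalSpace (V₁ x)] [FiberBundle F₁ V₁] [VectorBundle ℝ F₁ V₁]
  [ContMDiffVectorBundle ∞ F₁ V₁ 𝓘(ℝ, E)]
  {F₂ : Type*} [NormedAddCommGroup F₂] [NormedSpace ℝ F₂]
  {V₂ : M → Type*} [TopologicalSpace (TotalSpace F₂ V₂)] [∀ x, AddCommGroup (V₂ x)]
  [∀ x, Module ℝ (V₂ x)] [∀ x, TopologicalSpace (V₂ x)] [FiberBundle F₂ V₂] [VectorBundle ℝ F₂ V₂]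

/-- A local frame extends, after shrinking its domain, to global smooth sections. -/
theorem exists_global_localFrame {ι : Type*} (b : Basis ι ℝ F₁) (x₀ : M) :
    ∃ s : ι → Π x : M, V₁ x,
      (∀ i, ContMDiff 𝓘(ℝ, E) (𝓘(ℝ, E).prod 𝓘(ℝ, F₁)) ∞
        (fun x => (⟨x, s i x⟩ : TotalSpace F₁ V₁))) ∧
      ∀ᶠ y in nhds x₀, ∀ i, s i y = (trivializationAt F₁ V₁ x₀).localFrame b i y := by
  set e := trivializationAt F₁ V₁ x₀
  have hx : x₀ ∈ e.baseSet := FiberBundle.mem_baseSet_trivializationAt' x₀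
  -- The closed support of `f` lies in the trivializing set, so `f` times the local frame is smooth
  -- on all of `M`; near `x₀` the factor is `1`.
  obtain ⟨f, hf, -⟩ := (SmoothBumpFunction.nhds_basis_support (I := 𝓘(ℝ, E))
    (e.open_baseSet.mem_nhds hx)).mem_iff.1 (e.open_baseSet.mem_nhds hx)
  refine ⟨fun i => (f : M → ℝ) • e.localFrame b i, fun i => ?_, ?_⟩
  · exact ContMDiffOn.smul_section_of_tsupport f.contMDiff.contMDiffOn e.open_baseSet hf
      (e.contMDiffOn_localFrame_baseSet ∞ b i)
  · filter_upwards [f.eventuallyEq_one] with y hy i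
    simp [hy, e]

/-- Every vector in a fibre of a smooth vector bundle is the value of a global smooth section. -/
theorem exists_global_section [FiniteDimensional ℝ F₁] (x₀ : M) (v : V₁ x₀) :
    ∃ s : Π x : M, V₁ x, ContMDiff 𝓘(ℝ, E) (𝓘(ℝ, E).prod 𝓘(ℝ, F₁)) ∞
        (fun x => (⟨x, s x⟩ : TotalSpace F₁ V₁)) ∧ s x₀ = v := by
  let b := finBasis ℝ F₁
  set e := trivializationAt F₁ V₁ x₀
  have hx : x₀ ∈ e.baseSet := FiberBundle.mem_baseSet_trivializationAt' x₀
  obtain ⟨s, hs, hs'⟩ := exists_global_localFrame (E := E) (V₁ := V₁) b x₀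
  refine ⟨fun x => ∑ i, (e.basisAt b hx).repr v i • s i x,
    ContMDiff.sum_section fun i _ => ContMDiff.const_smul_section (hs i), ?_⟩
  have h := hs'.self_of_nhds
  simp only [h]
  simp [e, hx]

/-- The inverse of a bijective bundle map that preserves smooth sections preserves smooth
sections. -/
theorem contMDiff_of_bijective_map [FiniteDimensional ℝ F₁] [FiniteDimensional ℝ F₂]
    (A : ∀ x, V₁ x →ₗ[ℝ] V₂ x) (hbij : ∀ x, Function.Bijective (A x))
    (hA : ∀ s : Π x : M, V₁ x,
      ContMDiff 𝓘(ℝ, E) (𝓘(ℝ, E).prod 𝓘(ℝ, F₁)) ∞ (fun x => (⟨x, s x⟩ : TotalSpace F₁ V₁)) →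
      ContMDiff 𝓘(ℝ, E) (𝓘(ℝ, E).prod 𝓘(ℝ, F₂)) ∞
        (fun x => (⟨x, A x (s x)⟩ : TotalSpace F₂ V₂)))
    {s : Π x : M, V₁ x}
    (h : ContMDiff 𝓘(ℝ, E) (𝓘(ℝ, E).prod 𝓘(ℝ, F₂)) ∞
        (fun x => (⟨x, A x (s x)⟩ : TotalSpace F₂ V₂))) :
    ContMDiff 𝓘(ℝ, E) (𝓘(ℝ, E).prod 𝓘(ℝ, F₁)) ∞
      (fun x => (⟨x, s x⟩ : TotalSpace F₁ V₁)) := by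
  intro x₀
  let b := finBasis ℝ F₁
  obtain ⟨t, ht, ht'⟩ := exists_global_localFrame (E := E) (V₁ := V₁) b x₀
  set e₁ := trivializationAt F₁ V₁ x₀
  set e₂ := trivializationAt F₂ V₂ x₀
  have hx₁ : x₀ ∈ e₁.baseSet := FiberBundle.mem_baseSet_trivializationAt' x₀
  have hx₂ : x₀ ∈ e₂.baseSet := FiberBundle.mem_baseSet_trivializationAt' x₀
  let w (i) (y : M) : F₂ := (e₂ ⟨y, A y (t i y)⟩).2
  -- `A` is controlled only through its action on smooth sections, so its matrix is built from the
  -- images of the frame `t`. The coordinates of `s` then solve a linear system with smooth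
  -- coefficients and smooth right-hand side.
  let L (y : M) : (Fin (finrank ℝ F₁) → ℝ) →L[ℝ] F₂ :=
    ∑ i, (ContinuousLinearMap.proj (R := ℝ) (φ := fun _ => ℝ) i).smulRight (w i y)
  have hL (y : M) (c) : L y c = ∑ i, c i • w i y := by simp [L]
  have hw (i) : ContMDiffAt 𝓘(ℝ, E) 𝓘(ℝ, F₂) ∞ (w i) x₀ :=
    (contMDiffAt_section _).1 (hA _ (ht i) x₀)
  have hLs : ContMDiffAt 𝓘(ℝ, E) 𝓘(ℝ, (Fin (finrank ℝ F₁) → ℝ) →L[ℝ] F₂) ∞ L x₀ := by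
    refine contMDiffAt_finsetSum fun i _ => ?_
    have h1 : ContDiff ℝ ∞ (fun v : F₂ =>
      (ContinuousLinearMap.proj (R := ℝ) (φ := fun _ : Fin (finrank ℝ F₁) => ℝ) i).smulRight v) :=
      (ContinuousLinearMap.smulRightL ℝ (Fin (finrank ℝ F₁) → ℝ) F₂
        (ContinuousLinearMap.proj (R := ℝ) (φ := fun _ => ℝ) i)).contDiff
    exact h1.contDiffAt.comp_contMDiffAt (hw i)
  -- the coordinate expression of `A` in the frame `t`
  have key : ∀ᶠ y in nhds x₀, ∃ c : Fin (finrank ℝ F₁) → ℝ, s y = ∑ i, c i • t i y ∧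
      (L y).IsInvertible ∧ L y c = (e₂ ⟨y, A y (s y)⟩).2 := by
    filter_upwards [ht', e₁.open_baseSet.mem_nhds hx₁, e₂.open_baseSet.mem_nhds hx₂]
      with y hy hy₁ hy₂
    let B := e₁.basisAt b hy₁
    have hB (i) : t i y = B i := by rw [hy i]; simp [hy₁, B, e₁]
    let Q : (Fin (finrank ℝ F₁) → ℝ) ≃ₗ[ℝ] F₂ :=
      B.equivFun.symm.trans ((LinearEquiv.ofBijective (A y) (hbij y)).trans
        (e₂.linearEquivAt (R := ℝ) y hy₂))
    have hQ (c) : L y c = Q c := by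
      rw [hL]
      simp only [Q, LinearEquiv.trans_apply, Basis.equivFun_symm_apply, map_sum, map_smul, w, hB]
      rfl
    have hQ' : L y = (Q.toContinuousLinearEquiv : (Fin (finrank ℝ F₁) → ℝ) →L[ℝ] F₂) := by
      ext1 c; exact hQ c
    refine ⟨B.equivFun (s y), ?_, ⟨_, hQ'.symm⟩, ?_⟩
    · simp only [hB]; exact (B.sum_equivFun (s y)).symm
    · rw [hQ]
      simp only [Q, LinearEquiv.trans_apply, LinearEquiv.symm_apply_apply]
      rfl
  -- `ContinuousLinearMap.inverse` takes the value zero on non-invertible maps, so `c` is meaningful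
  -- only near `x₀`, which suffices. Inversion is smooth at invertible maps.
  let c (y : M) : Fin (finrank ℝ F₁) → ℝ := (L y).inverse (e₂ ⟨y, A y (s y)⟩).2
  have hc : ContMDiffAt 𝓘(ℝ, E) 𝓘(ℝ, Fin (finrank ℝ F₁) → ℝ) ∞ c x₀ := by
    obtain ⟨_, -, hi, -⟩ := key.self_of_nhds
    have h1 : ContMDiffAt 𝓘(ℝ, E) 𝓘(ℝ, F₂ →L[ℝ] (Fin (finrank ℝ F₁) → ℝ)) ∞
        (fun y => (L y).inverse) x₀ :=
      ContDiffAt.comp_contMDiffAt (x := x₀) (g := ContinuousLinearMap.inverse) (f := L)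
        hi.contDiffAt_map_inverse hLs
    exact h1.clm_apply ((contMDiffAt_section _).1 (h x₀))
  have hs : ContMDiffAt 𝓘(ℝ, E) (𝓘(ℝ, E).prod 𝓘(ℝ, F₁)) ∞
      (fun x => (⟨x, ∑ i, c x i • t i x⟩ : TotalSpace F₁ V₁)) x₀ := by
    refine ContMDiffAt.sum_section fun i _ => ?_
    exact ContMDiffAt.smul_section (f := fun x => c x i) (contMDiffAt_pi_space.1 hc i) (ht i x₀)
  refine hs.congr_of_eventuallyEq ?_
  filter_upwards [key] with y hy
  obtain ⟨c', hc', hi, hLc⟩ := hy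
  have : c y = c' := by
    change (L y).inverse _ = _
    rw [← hLc]
    obtain ⟨Q, hQ⟩ := hi
    rw [← hQ]; simp
  rw [hc', this]

end SmoothBundles

/-! ### Bilinearity and symmetry of the natural pairing. -/

section Pairing

variable {E : Type*} [NormedAddCommGroup E] [NormedSpace ℝ E]
  {M : Type*} [TopologicalSpace M] [ChartedSpace E M]

theorem pairing_add_left {x : M} (u v w : GTan E x) :
    pairing (u + v) w = pairing u w + pairing v w := by
  simp [pairing]; ring

theorem pairing_smul_left {x : M} (c : ℝ) (u v : GTan E x) :
    pairing (c • u) v = c * pairing u v := by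
  simp [pairing]; ring

theorem pairing_smul_right {x : M} (c : ℝ) (u v : GTan E x) :
    pairing u (c • v) = c * pairing u v := by
  simp [pairing]; ring

theorem pairing_neg_left {x : M} (u v : GTan E x) : pairing (-u) v = -pairing u v := by
  simp [pairing]; ring

theorem pairing_neg_right {x : M} (u v : GTan E x) : pairing u (-v) = -pairing u v := by
  simp [pairing]; ring

theorem pairing_sub_left {x : M} (u v w : GTan E x) :
    pairing (u - v) w = pairing u w - pairing v w := by
  simp [pairing]; ring

theorem pairing_comm {x : M} (u v : GTan E x) : pairing u v = pairing v u := by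
  simp [pairing]; ring

end Pairing

/-! ### The splitting into `C_+` and `C_-`, and smoothness of the lifts. -/

section Lifts

variable {E : Type*} [NormedAddCommGroup E] [NormedSpace ℝ E] [FiniteDimensional ℝ E]
  {M : Type*} [TopologicalSpace M] [ChartedSpace E M] [IsManifold 𝓘(ℝ, E) ∞ M]
  {γ : ClosedThreeForm E M} (K : GenKahler γ)

theorem sign_sq (σ : ℤˣ) : ((σ : ℤ) : ℝ) * ((σ : ℤ) : ℝ) = 1 := by
  rcases Int.units_eq_one_or σ with rfl | rfl <;> simp

namespace GenKahler

theorem mem_C_iff {σ : ℤˣ} {x : M} {u : GTan E x} :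
    u ∈ K.C σ x ↔ K.G x u = ((σ : ℤ) : ℝ) • u := End.mem_eigenspace_iff

/-- `J` and `J'` are orthogonal with square `-1`, hence skew-adjoint; as they commute, their product
is self-adjoint. This makes `C_+` and `C_-` orthogonal. -/
theorem pairing_G_left (x : M) (u v : GTan E x) : pairing (K.G x u) v = pairing u (K.G x v) := by
  have h1 := K.J.orthogonal x (K.J'.toFun x u) (K.J.toFun x v)
  have h2 := K.J'.orthogonal x u (K.J'.toFun x (K.J.toFun x v))
  rw [K.J.sq] at h1
  rw [K.J'.sq] at h2
  simp only [G, LinearMap.neg_apply, LinearMap.comp_apply, pairing_neg_left, pairing_neg_right,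
    K.comm x v] at h1 h2 ⊢
  linarith

theorem pairing_eq_zero {σ τ : ℤˣ} (h : τ = -σ) {x : M} {u v : GTan E x} (hu : u ∈ K.C σ x)
    (hv : v ∈ K.C τ x) : pairing u v = 0 := by
  have := K.pairing_G_left x u v
  rw [K.mem_C_iff.1 hu, K.mem_C_iff.1 hv, pairing_smul_left, pairing_smul_right, h] at this
  rcases Int.units_eq_one_or σ with rfl | rfl <;> simp at this <;> linarith

theorem G_pos (x : M) {u : GTan E x} (hu : u ≠ 0) : 0 < pairing (K.G x u) u := K.pos x u hu

theorem lift_mem (σ : ℤˣ) (x : M) (X : Tan E x) : K.lift σ x X ∈ K.C σ x :=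
  ((K.aEquiv σ x).symm X).2

@[simp]
theorem lift_fst (σ : ℤˣ) (x : M) (X : Tan E x) : (K.lift σ x X).1 = X :=
  (K.aEquiv σ x).apply_symm_apply X

theorem lift_eq_of_mem {σ : ℤˣ} {x : M} {u : GTan E x} (hu : u ∈ K.C σ x) :
    K.lift σ x u.1 = u :=
  congrArg Subtype.val ((K.aEquiv σ x).symm_apply_apply ⟨u, hu⟩)

/-- The projection of the generalized tangent space onto `C_σ`. -/
def proj (σ : ℤˣ) (x : M) : GTan E x →ₗ[ℝ] GTan E x :=
  (2⁻¹ : ℝ) • (LinearMap.id + ((σ : ℤ) : ℝ) • K.G x)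

theorem proj_apply (σ : ℤˣ) (x : M) (u : GTan E x) :
    K.proj σ x u = (2⁻¹ : ℝ) • (u + ((σ : ℤ) : ℝ) • K.G x u) := rfl

theorem proj_mem (σ : ℤˣ) (x : M) (u : GTan E x) : K.proj σ x u ∈ K.C σ x := by
  have h : ((σ : ℤ) : ℝ) • (u + ((σ : ℤ) : ℝ) • K.G x u) = ((σ : ℤ) : ℝ) • u + K.G x u := by
    rw [smul_add, smul_smul, sign_sq, one_smul]
  rw [mem_C_iff, proj_apply, map_smul, map_add, map_smul, K.G_G, smul_comm _ (2⁻¹ : ℝ), h, add_comm]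

theorem proj_of_mem {σ : ℤˣ} {x : M} {u : GTan E x} (hu : u ∈ K.C σ x) : K.proj σ x u = u := by
  rw [proj_apply, K.mem_C_iff.1 hu, smul_smul, sign_sq]; module

theorem proj_add_proj (σ : ℤˣ) (x : M) (u : GTan E x) :
    K.proj σ x u + K.proj (-σ) x u = u := by
  simp only [proj_apply, Units.val_neg, Int.cast_neg]; module

theorem lift_proj (σ : ℤˣ) (x : M) (u : GTan E x) :
    K.lift σ x (K.proj σ x u).1 = K.proj σ x u := K.lift_eq_of_mem (K.proj_mem σ x u)

theorem pairing_proj {σ : ℤˣ} {x : M} (u : GTan E x) {v : GTan E x} (hv : v ∈ K.C σ x) :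
    pairing (K.proj σ x u) v = pairing u v := by
  conv_rhs => rw [← K.proj_add_proj σ x u, pairing_add_left,
    K.pairing_eq_zero (neg_neg σ).symm (K.proj_mem (-σ) x u) hv, add_zero]

theorem J_G (x : M) (u : GTan E x) : K.G x (K.J.toFun x u) = K.J.toFun x (K.G x u) := by
  simp [G, K.comm]

theorem J'_G (x : M) (u : GTan E x) : K.G x (K.J'.toFun x u) = K.J'.toFun x (K.G x u) := by
  simp [G, K.comm]

theorem J_mem {σ : ℤˣ} {x : M} {u : GTan E x} (hu : u ∈ K.C σ x) : K.J.toFun x u ∈ K.C σ x := by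
  rw [mem_C_iff, K.J_G, K.mem_C_iff.1 hu, map_smul]

theorem J'_eq {σ : ℤˣ} {x : M} {u : GTan E x} (hu : u ∈ K.C σ x) :
    K.J'.toFun x u = ((σ : ℤ) : ℝ) • K.J.toFun x u := by
  rw [← map_smul, ← K.mem_C_iff.1 hu]
  simp [G, K.J.sq]

theorem proj_J (σ : ℤˣ) (x : M) (u : GTan E x) :
    K.proj σ x (K.J.toFun x u) = K.J.toFun x (K.proj σ x u) := by
  simp [proj_apply, K.J_G]

theorem proj_J' (σ : ℤˣ) (x : M) (u : GTan E x) :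
    K.proj σ x (K.J'.toFun x u) = K.J'.toFun x (K.proj σ x u) := by
  simp [proj_apply, K.J'_G]

theorem lift_cplx (σ : ℤˣ) (x : M) (X : Tan E x) :
    K.lift σ x (K.cplx σ x X) = K.J.toFun x (K.lift σ x X) :=
  K.lift_eq_of_mem (K.J_mem (K.lift_mem σ x X))

/-- The bijection `T*M → TM` given by `ξ ↦ a (G ξ)`. -/
def sharp (x : M) : Cot E x →ₗ[ℝ] Tan E x :=
  LinearMap.fst ℝ (Tan E x) (Cot E x) ∘ₗ K.G x ∘ₗ LinearMap.inr ℝ (Tan E x) (Cot E x)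

/-- `T*M` is isotropic: if `a (G ξ) = 0`, then `G ξ` is again a covector and `⟨G ξ, ξ⟩ = 0`, against
positivity of `G` unless `ξ = 0`. Equality of dimensions does the rest. -/
theorem sharp_bijective (x : M) : Function.Bijective (K.sharp x) := by
  have : FiniteDimensional ℝ (Tan E x) := inferInstanceAs (FiniteDimensional ℝ E)
  have : FiniteDimensional ℝ (Cot E x) := inferInstanceAs (FiniteDimensional ℝ (E →L[ℝ] ℝ))
  have hdim : finrank ℝ (Cot E x) = finrank ℝ (Tan E x) := by
    have e : (E →L[ℝ] ℝ) ≃ₗ[ℝ] (E →ₗ[ℝ] ℝ) := LinearMap.toContinuousLinearMap.symm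
    have h1 : finrank ℝ (E →L[ℝ] ℝ) = finrank ℝ E := by
      rw [e.finrank_eq]; exact Subspace.dual_finrank_eq
    exact h1
  have hinj : Function.Injective (K.sharp x) := by
    rw [injective_iff_map_eq_zero]
    intro ξ h
    by_contra hne
    have h0 : ((0 : Tan E x), ξ) ≠ 0 := fun h => hne (congrArg Prod.snd h)
    have hp := K.G_pos x h0
    have h : (K.G x (0, ξ)).1 = 0 := h
    simp [pairing, h] at hp
  exact ⟨hinj, (LinearMap.injective_iff_surjective_of_finrank_eq_finrank hdim).1 hinj⟩

/-- Because `G ^ 2 = 1`, the vector `G ξ + σ ξ` is a `σ`-eigenvector, and its anchor is `sharp ξ`.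
This writes the lift through the smooth map `G` and the inverse of `sharp`, which is how its
smoothness is reached. -/
theorem lift_eq_sharp (σ : ℤˣ) (x : M) (ξ : Cot E x) :
    K.lift σ x (K.sharp x ξ) = K.G x (0, ξ) + ((σ : ℤ) : ℝ) • ((0 : Tan E x), ξ) := by
  have h : K.G x (0, ξ) + ((σ : ℤ) : ℝ) • ((0 : Tan E x), ξ) ∈ K.C σ x := by
    rw [mem_C_iff, map_add, map_smul, K.G_G, smul_add, smul_smul, sign_sq, one_smul, add_comm]
  have := K.lift_eq_of_mem h
  rw [← this]
  congr 1
  simp [sharp]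

theorem G_genFields {u : Π x : M, GTan E x} (hu : u ∈ genFields E M) :
    (fun x => K.G x (u x)) ∈ genFields E M := by
  have := neg_mem (K.J.smooth _ (K.J'.smooth _ hu))
  exact this

omit [FiniteDimensional ℝ E] in
theorem smul_genFields (c : ℝ) {u : Π x : M, GTan E x} (hu : u ∈ genFields E M) :
    (fun x => c • u x) ∈ genFields E M :=
  (genFields E M).smul_mem (algebraMap ℝ (RFun E M) c) hu

theorem proj_genFields (σ : ℤˣ) {u : Π x : M, GTan E x} (hu : u ∈ genFields E M) :
    (fun x => K.proj σ x (u x)) ∈ genFields E M :=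
  smul_genFields _ (add_mem hu (smul_genFields _ (K.G_genFields hu)))

variable [T2Space M]

theorem sharp_symm_smooth {ξ : Π x : M, Cot E x}
    (h : (fun x => K.sharp x (ξ x)) ∈ vectorFields E M) : ξ ∈ oneForms E M := by
  -- `sharp` sends smooth one-forms to smooth vector fields because `G` preserves smooth sections;
  -- the general statement on inverses of bundle maps applies.
  refine contMDiff_of_bijective_map (F₁ := E →L[ℝ] ℝ) (F₂ := E)
    (V₁ := fun x : M => Tan E x →L[ℝ] Trivial M ℝ x) (V₂ := fun x : M => Tan E x)
    K.sharp K.sharp_bijective (fun s hs => ?_) h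
  exact (K.G_genFields (u := fun x => (0, s x)) ⟨zero_mem _, hs⟩).1

theorem lift_genFields (σ : ℤˣ) {X : Π x : M, Tan E x} (hX : X ∈ vectorFields E M) :
    (fun x => K.lift σ x (X x)) ∈ genFields E M := by
  choose ξ hξ using fun x => (K.sharp_bijective x).2 (X x)
  have hs : ξ ∈ oneForms E M := K.sharp_symm_smooth (by simpa only [hξ] using hX)
  have h0 : (fun x => ((0 : Tan E x), ξ x)) ∈ genFields E M := ⟨zero_mem _, hs⟩
  have : (fun x => K.lift σ x (X x)) =
      (fun x => K.G x (0, ξ x)) + fun x => ((σ : ℤ) : ℝ) • ((0 : Tan E x), ξ x) := by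
    ext1 x
    rw [← hξ x, K.lift_eq_sharp]; rfl
  rw [this]
  exact add_mem (K.G_genFields h0) (smul_genFields _ h0)

end GenKahler

end Lifts

/-! ### Algebraic identities of the Courant-Dorfman bracket. -/

section CourantIdentities

variable {E : Type*} [NormedAddCommGroup E] [NormedSpace ℝ E] [FiniteDimensional ℝ E]
  {M : Type*} [TopologicalSpace M] [T2Space M] [ChartedSpace E M] [IsManifold 𝓘(ℝ, E) ∞ M]
  {γ : ClosedThreeForm E M}

theorem exists_vectorField (x : M) (w : Tan E x) : ∃ W ∈ vectorFields E M, W x = w :=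
  exists_global_section (E := E) (F₁ := E) (V₁ := fun x : M => Tan E x) x w

omit [FiniteDimensional ℝ E] [T2Space M] [IsManifold 𝓘(ℝ, E) ∞ M] in
theorem lie_swap (X Y : Π x : M, Tan E x) (x : M) : lie X Y x = -lie Y X x :=
  VectorField.mlieBracket_swap_apply

omit [T2Space M] in
theorem lie_add_left {X X' : Π x : M, Tan E x} (hX : X ∈ vectorFields E M)
    (hX' : X' ∈ vectorFields E M) (Y : Π x : M, Tan E x) (x : M) :
    lie (X + X') Y x = lie X Y x + lie X' Y x :=
  VectorField.mlieBracket_add_left (vectorFields.mdiff hX x) (vectorFields.mdiff hX' x)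

omit [T2Space M] in
theorem lie_add_right (X : Π x : M, Tan E x) {Y Y' : Π x : M, Tan E x}
    (hY : Y ∈ vectorFields E M) (hY' : Y' ∈ vectorFields E M) (x : M) :
    lie X (Y + Y') x = lie X Y x + lie X Y' x :=
  VectorField.mlieBracket_add_right (vectorFields.mdiff hY x) (vectorFields.mdiff hY' x)

omit [T2Space M] [FiniteDimensional ℝ E] in
theorem dir_add_apply (X : Π x : M, Tan E x) {ξ η : Π x : M, Cot E x} (hξ : ξ ∈ oneForms E M)
    (hη : η ∈ oneForms E M) {Y Z : Π x : M, Tan E x} (hY : Y ∈ vectorFields E M)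
    (hZ : Z ∈ vectorFields E M) (x : M) :
    dir X (fun y => (ξ y (Y y) + η y (Z y) : ℝ)) x
      = dir X (fun y => (ξ y (Y y) : ℝ)) x + dir X (fun y => (η y (Z y) : ℝ)) x := by
  have h1 := oneForms.mdiff hξ x (vectorFields.mdiff hY x)
  have h2 := oneForms.mdiff hη x (vectorFields.mdiff hZ x)
  have := mvfderiv_add h1 h2
  exact congrArg (fun L => L (X x)) this

omit [T2Space M] [FiniteDimensional ℝ E] [IsManifold 𝓘(ℝ, E) ∞ M] in
theorem dir_div_two (X : Π x : M, Tan E x) (f : M → ℝ) (x : M) (hf : MDiffAt f x) :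
    dir X (fun y => f y / 2) x = dir X f x / 2 := by
  have h2 : (fun y => f y / 2) = (fun _ => (2⁻¹ : ℝ)) * f := by
    ext y; simp; ring
  have h := mvfderiv_mul (I := 𝓘(ℝ, E)) (mdifferentiableAt_const (c := (2⁻¹ : ℝ))) hf
  simp only [dir, h2, h]
  simp [mvfderiv_const]
  ring

omit [T2Space M] in
theorem dorfman_snd_apply (u v : genFields E M) {W : Π x : M, Tan E x}
    (hW : W ∈ vectorFields E M) (x : M) :
    ((dorfman γ u v x).2 (W x) : ℝ) =
      dir (fun y => (u.1 y).1) (fun y => (v.1 y).2 (W y)) x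
        - (v.1 x).2 (lie (fun y => (u.1 y).1) W x)
        - (dir (fun y => (v.1 y).1) (fun y => (u.1 y).2 (W y)) x
          - dir W (fun y => (u.1 y).2 (v.1 y).1) x - (u.1 x).2 (lie (fun y => (v.1 y).1) W x))
        + γ.toFun x ![(v.1 x).1, (u.1 x).1, W x] := by
  have h1 := lieForm_apply (fun y => (u.1 y).1) ⟨_, v.2.2⟩ hW x
  have h2 := contractD_apply ⟨_, v.2.1⟩ ⟨_, u.2.2⟩ hW x
  have h3 := γ.contract_apply (u.1 x).1 (v.1 x).1 (W x)
  simp only [dorfman, _root_.add_apply, _root_.sub_apply]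
  rw [h1, h2, h3]

omit [T2Space M] in
omit [FiniteDimensional ℝ E] in
theorem threeForm_swap₀₁ (x : M) (X Y Z : Tan E x) :
    γ.toFun x ![X, Y, Z] = -γ.toFun x ![Y, X, Z] := by
  have := (γ.toFun x).map_swap ![Y, X, Z] (i := 0) (j := 1) (by decide)
  refine Eq.trans (congrArg (γ.toFun x) ?_) this
  ext i; fin_cases i <;> rfl

omit [T2Space M] in
omit [FiniteDimensional ℝ E] in
theorem threeForm_swap₀₂ (x : M) (X Y Z : Tan E x) :
    γ.toFun x ![X, Y, Z] = -γ.toFun x ![Z, Y, X] := by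
  have := (γ.toFun x).map_swap ![Z, Y, X] (i := 0) (j := 2) (by decide)
  refine Eq.trans (congrArg (γ.toFun x) ?_) this
  ext i; fin_cases i <;> rfl

/-- Every tangent vector extends to a global vector field, so bracket identities can be tested with
the invariant formula `dorfman_snd_apply`. -/
theorem gTan_ext {x : M} {p q : GTan E x} (h1 : p.1 = q.1)
    (h2 : ∀ W ∈ vectorFields E M, (p.2 (W x) : ℝ) = q.2 (W x)) : p = q := by
  refine Prod.ext h1 (ContinuousLinearMap.ext fun w => ?_)
  obtain ⟨W, hW, rfl⟩ := exists_vectorField x w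
  exact h2 W hW

theorem dorfman_add_left (u u' v : genFields E M) (x : M) :
    dorfman γ (u + u') v x = dorfman γ u v x + dorfman γ u' v x := by
  refine gTan_ext (lie_add_left u.2.1 u'.2.1 _ x) fun W hW => ?_
  have h1 := dir_add_apply (fun y => (v.1 y).1) u.2.2 u'.2.2 hW hW x
  have h2 := dir_add_apply W u.2.2 u'.2.2 v.2.1 v.2.1 x
  have h3 := lie_add_left u.2.1 u'.2.1 W x
  have h4 : γ.toFun x ![(v.1 x).1, (u.1 x).1 + (u'.1 x).1, W x]
      = γ.toFun x ![(v.1 x).1, (u.1 x).1, W x] + γ.toFun x ![(v.1 x).1, (u'.1 x).1, W x] := by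
    have := (γ.toFun x).map_update_add ![(v.1 x).1, 0, W x] 1 (u.1 x).1 (u'.1 x).1
    convert this using 2 <;> [skip; congr 1; congr 1] <;> (ext i; fin_cases i <;> rfl)
  have h5 : dir (fun y => ((u + u').1 y).1) (fun y => (v.1 y).2 (W y)) x
      = dir (fun y => (u.1 y).1) (fun y => (v.1 y).2 (W y)) x
        + dir (fun y => (u'.1 y).1) (fun y => (v.1 y).2 (W y)) x := map_add _ _ _
  have h6 : lie (fun y => ((u + u').1 y).1) W x
      = lie (fun y => (u.1 y).1) W x + lie (fun y => (u'.1 y).1) W x := h3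
  simp only [Prod.snd_add, _root_.add_apply]
  rw [dorfman_snd_apply _ _ hW, dorfman_snd_apply _ _ hW, dorfman_snd_apply _ _ hW, h5, h6, map_add]
  have e1 (y : M) : (u + u').1 y = u.1 y + u'.1 y := rfl
  simp only [e1, Prod.snd_add, Prod.fst_add, _root_.add_apply, h1, h2, h4]
  ring

theorem dorfman_add_right (u v v' : genFields E M) (x : M) :
    dorfman γ u (v + v') x = dorfman γ u v x + dorfman γ u v' x := by
  refine gTan_ext (lie_add_right _ v.2.1 v'.2.1 x) fun W hW => ?_
  have h1 := dir_add_apply (fun y => (u.1 y).1) v.2.2 v'.2.2 hW hW x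
  have h2 := dir_add_apply W u.2.2 u.2.2 v.2.1 v'.2.1 x
  have h4 : γ.toFun x ![(v.1 x).1 + (v'.1 x).1, (u.1 x).1, W x]
      = γ.toFun x ![(v.1 x).1, (u.1 x).1, W x] + γ.toFun x ![(v'.1 x).1, (u.1 x).1, W x] := by
    have := (γ.toFun x).map_update_add ![0, (u.1 x).1, W x] 0 (v.1 x).1 (v'.1 x).1
    convert this using 2 <;> [skip; congr 1; congr 1] <;> (ext i; fin_cases i <;> rfl)
  have h5 : dir (fun y => ((v + v').1 y).1) (fun y => (u.1 y).2 (W y)) x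
      = dir (fun y => (v.1 y).1) (fun y => (u.1 y).2 (W y)) x
        + dir (fun y => (v'.1 y).1) (fun y => (u.1 y).2 (W y)) x := map_add _ _ _
  have h6 : lie (fun y => ((v + v').1 y).1) W x
      = lie (fun y => (v.1 y).1) W x + lie (fun y => (v'.1 y).1) W x :=
    lie_add_left v.2.1 v'.2.1 W x
  simp only [Prod.snd_add, _root_.add_apply]
  rw [dorfman_snd_apply _ _ hW, dorfman_snd_apply _ _ hW, dorfman_snd_apply _ _ hW, h5, h6, map_add]
  have e1 (y : M) : (v + v').1 y = v.1 y + v'.1 y := rfl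
  simp only [e1, Prod.snd_add, Prod.fst_add, _root_.add_apply, map_add, h1, h2, h4]
  ring

variable (γ) in
/-- The Courant-Dorfman bracket, evaluated at a point, as a biadditive map. -/
def dorfmanHom (x : M) : genFields E M →+ genFields E M →+ GTan E x :=
  AddMonoidHom.mk' (fun u => AddMonoidHom.mk' (fun v => dorfman γ u v x)
    fun v v' => dorfman_add_right u v v' x)
    fun u u' => AddMonoidHom.ext fun v => dorfman_add_left u u' v x

theorem dorfman_neg_left (u v : genFields E M) (x : M) :
    dorfman γ (-u) v x = -dorfman γ u v x :=
  DFunLike.congr_fun (map_neg (dorfmanHom γ x) u) v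

theorem dorfman_neg_right (u v : genFields E M) (x : M) :
    dorfman γ u (-v) x = -dorfman γ u v x :=
  map_neg (dorfmanHom γ x u) v

omit [T2Space M] in
omit [FiniteDimensional ℝ E] in
theorem dir_pairing (X : Π x : M, Tan E x) (u v : genFields E M) (x : M) :
    dir X (fun y => pairing (u.1 y) (v.1 y)) x =
      (dir X (fun y => (v.1 y).2 (u.1 y).1) x + dir X (fun y => (u.1 y).2 (v.1 y).1) x) / 2 := by
  have h1 := oneForms.mdiff v.2.2 x (vectorFields.mdiff u.2.1 x)
  have h2 := oneForms.mdiff u.2.2 x (vectorFields.mdiff v.2.1 x)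
  have h := dir_div_two X _ x (h1.add h2)
  have h' := dir_add_apply X v.2.2 u.2.2 u.2.1 v.2.1 x
  rw [← h']
  exact h

-- The derivation property of the bracket with respect to the pairing. The two `γ` terms cancel by
-- skew-symmetry. It supplies both metric compatibility and skew torsion of the Bismut connection.
omit [T2Space M] in
theorem dir_pairing_eq (u v w : genFields E M) (x : M) :
    dir (fun y => (u.1 y).1) (fun y => pairing (v.1 y) (w.1 y)) x =
      pairing (dorfman γ u v x) (w.1 x) + pairing (v.1 x) (dorfman γ u w x) := by
  rw [dir_pairing]
  simp only [pairing]
  rw [dorfman_snd_apply _ _ w.2.1, dorfman_snd_apply _ _ v.2.1,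
    threeForm_swap₀₂ x (w.1 x).1, lie_swap (fun y => (w.1 y).1), map_neg]
  simp only [dorfman]
  ring

/-- The symmetric part `u * v + v * u` of the bracket is `2 d⟨u, v⟩`, which vanishes for orthogonal
sections. The case needed is one section in `C_+` and one in `C_-`. -/
theorem dorfman_swap_of_pairing_eq_zero (u v : genFields E M)
    (h : ∀ x, pairing (u.1 x) (v.1 x) = 0) (x : M) : dorfman γ u v x = -dorfman γ v u x := by
  refine gTan_ext (lie_swap _ _ x) fun W hW => ?_
  have h1 := dir_pairing W u v x
  have h2 : (fun y => pairing (u.1 y) (v.1 y)) = fun _ => (0 : ℝ) := funext h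
  have h3 : dir W (fun _ : M => (0 : ℝ)) x = 0 := by simp [dir, mvfderiv_const]
  rw [h2, h3] at h1
  simp only [Prod.snd_neg, _root_.neg_apply]
  rw [dorfman_snd_apply _ _ hW, dorfman_snd_apply _ _ hW, threeForm_swap₀₁ x (v.1 x).1]
  linarith

/-- The action of a generalized almost complex structure on smooth sections. -/
def GenAlmostComplex.sec (J : GenAlmostComplex E M) (u : genFields E M) : genFields E M :=
  ⟨fun x => J.toFun x (u.1 x), J.smooth _ u.2⟩

/-- The Nijenhuis tensor of an integrable generalized complex structure vanishes. -/
theorem GenAlmostComplex.IsIntegrable.nijenhuis {J : GenAlmostComplex E M}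
    (hJ : J.IsIntegrable γ) (u v : genFields E M) (x : M) :
    dorfman γ u (J.sec v) x + dorfman γ (J.sec u) v x
      = J.toFun x (dorfman γ u v x - dorfman γ (J.sec u) (J.sec v) x) := by
  -- Integrability is applied to the sections `u - i J u` and `v - i J v` of the `i`-eigenbundle;
  -- the real part of the eigenvector equation for their bracket is the identity.
  have hmem (w : genFields E M) (y : M) :
      Cx.mk (w.1 y) (-J.toFun y (w.1 y)) ∈ J.eig Complex.I y := by
    refine End.mem_eigenspace_iff.2 ?_
    ext1 <;> simp [J.sq]
  have h := hJ ⟨fun y => Cx.mk (u.1 y) (-J.toFun y (u.1 y)), u.2, (-J.sec u).2⟩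
    ⟨fun y => Cx.mk (v.1 y) (-J.toFun y (v.1 y)), v.2, (-J.sec v).2⟩ (hmem u) (hmem v) x
  have h := congrArg Cx.re (End.mem_eigenspace_iff.1 h)
  have h' : J.toFun x (dorfman γ u v x - dorfman γ (-J.sec u) (-J.sec v) x)
      = (0 : ℝ) • (dorfman γ u v x - dorfman γ (-J.sec u) (-J.sec v) x)
        - (1 : ℝ) • (dorfman γ u (-J.sec v) x + dorfman γ (-J.sec u) v x) := h
  simp only [dorfman_neg_left, dorfman_neg_right, neg_neg] at h'
  rw [h']
  module

end CourantIdentities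

/-! ### The Bismut connection expressed through the Courant-Dorfman bracket. -/

section Bismut

variable {E : Type*} [NormedAddCommGroup E] [NormedSpace ℝ E] [FiniteDimensional ℝ E]
  {M : Type*} [TopologicalSpace M] [ChartedSpace E M] [IsManifold 𝓘(ℝ, E) ∞ M]
  {γ : ClosedThreeForm E M} (K : GenKahler γ)

omit [FiniteDimensional ℝ E] [IsManifold 𝓘(ℝ, E) ∞ M] in
theorem dir_neg (X : Π x : M, Tan E x) (f : M → ℝ) (x : M) :
    dir X (fun y => -f y) x = -dir X f x := by
  have : mvfderiv 𝓘(ℝ, E) (fun y => -f y) x = -mvfderiv 𝓘(ℝ, E) f x := mvfderiv_neg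
  simp [dir, this]

omit [FiniteDimensional ℝ E] [IsManifold 𝓘(ℝ, E) ∞ M] in
theorem dir_sign_mul (σ : ℤˣ) (X : Π x : M, Tan E x) (f : M → ℝ) (x : M) :
    dir X (fun y => ((σ : ℤ) : ℝ) * f y) x = ((σ : ℤ) : ℝ) * dir X f x := by
  rcases Int.units_eq_one_or σ with rfl | rfl <;> simp [dir_neg]

namespace GenKahler

/-- For `σ = -1`: the difference of the two lifts of a vector is a covector, and two covectors pair
to zero. Expanding, the cross terms drop out since `C_+` and `C_-` are orthogonal. -/
theorem metric_eq (σ : ℤˣ) (x : M) (X Y : Tan E x) :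
    K.metric x X Y = ((σ : ℤ) : ℝ) * pairing (K.lift σ x X) (K.lift σ x Y) := by
  rcases Int.units_eq_one_or σ with rfl | rfl
  · simp [metric]
  · have h1 := K.pairing_eq_zero (τ := -1) rfl (K.lift_mem 1 x X) (K.lift_mem (-1) x Y)
    have h2 := K.pairing_eq_zero (τ := -1) rfl (K.lift_mem 1 x Y) (K.lift_mem (-1) x X)
    have h3 : pairing (K.lift 1 x X - K.lift (-1) x X) (K.lift 1 x Y - K.lift (-1) x Y) = 0 := by
      simp [pairing]
    simp only [pairing, metric, Prod.snd_sub, Prod.fst_sub, lift_fst, _root_.sub_apply, sub_self,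
      Units.val_neg, Units.val_one, Int.cast_neg, Int.cast_one] at *
    linarith

theorem metric_comm (x : M) (X Y : Tan E x) : K.metric x X Y = K.metric x Y X :=
  pairing_comm _ _

theorem metric_sub_left (x : M) (X X' Y : Tan E x) :
    K.metric x (X - X') Y = K.metric x X Y - K.metric x X' Y := by
  simp [metric, pairing_sub_left]

theorem metric_cplx (σ : ℤˣ) (x : M) (X Y : Tan E x) :
    K.metric x (K.cplx σ x X) Y = -K.metric x X (K.cplx σ x Y) := by
  have := K.J.orthogonal x (K.lift σ x X) (K.J.toFun x (K.lift σ x Y))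
  rw [K.J.sq, pairing_neg_right] at this
  rw [K.metric_eq σ, K.metric_eq σ, K.lift_cplx, K.lift_cplx, ← this]
  ring

theorem cplx_cplx (σ : ℤˣ) (x : M) (X : Tan E x) : K.cplx σ x (K.cplx σ x X) = -X := by
  rw [← K.lift_fst σ x (K.cplx σ x (K.cplx σ x X)), K.lift_cplx, K.lift_cplx, K.J.sq]
  simp

theorem eq_zero_of_metric_self {x : M} {X : Tan E x} (h : K.metric x X X = 0) : X = 0 := by
  by_contra hX
  have h0 : K.lift 1 x X ≠ 0 := fun h0 => hX (by rw [← K.lift_fst 1 x X, h0]; rfl)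
  have := K.G_pos x h0
  rw [K.mem_C_iff.1 (K.lift_mem 1 x X)] at this
  simp only [Units.val_one, Int.cast_one, one_smul] at this
  exact this.ne' h

variable [T2Space M]

/-- The lift of a smooth vector field to a smooth section of `C_σ`. -/
def liftSec (σ : ℤˣ) (X : vectorFields E M) : genFields E M :=
  ⟨fun x => K.lift σ x (X.1 x), K.lift_genFields σ X.2⟩

theorem liftSec_fst (σ : ℤˣ) (X : vectorFields E M) :
    (fun y => ((K.liftSec σ X).1 y).1) = X.1 := funext fun y => K.lift_fst σ y (X.1 y)

/-- The action of `I_σ` on smooth vector fields. -/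
def cplxSec (σ : ℤˣ) (X : vectorFields E M) : vectorFields E M :=
  ⟨fun x => K.cplx σ x (X.1 x), (K.J.smooth _ (K.liftSec σ X).2).1⟩

/-- The generalized Bismut connection `(X, Y) ↦ a (a_{-σ}⁻¹ X * a_σ⁻¹ Y)_σ`. -/
def genBismut (σ : ℤˣ) (X Y : vectorFields E M) (x : M) : Tan E x :=
  (K.proj σ x (dorfman γ (K.liftSec (-σ) X) (K.liftSec σ Y) x)).1

/-- Pairing with a vector of `C_σ` does not see the `C_{-σ}` component, so the projection in
`genBismut` may be dropped. -/
theorem metric_genBismut (σ : ℤˣ) (X Y Z : vectorFields E M) (x : M) :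
    K.metric x (K.genBismut σ X Y x) (Z.1 x) =
      ((σ : ℤ) : ℝ) *
        pairing (dorfman γ (K.liftSec (-σ) X) (K.liftSec σ Y) x) ((K.liftSec σ Z).1 x) := by
  rw [K.metric_eq σ, genBismut, K.lift_proj]
  congr 1
  exact K.pairing_proj _ (K.lift_mem _ _ _)

theorem dir_metric (σ : ℤˣ) (X Y Z : vectorFields E M) (x : M) :
    dir X.1 (fun y => K.metric y (Y.1 y) (Z.1 y)) x
      = K.metric x (K.genBismut σ X Y x) (Z.1 x) + K.metric x (Y.1 x) (K.genBismut σ X Z x) := by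
  have h := dir_pairing_eq (γ := γ) (K.liftSec (-σ) X) (K.liftSec σ Y) (K.liftSec σ Z) x
  rw [K.liftSec_fst] at h
  rw [K.metric_comm x (Y.1 x), K.metric_genBismut, K.metric_genBismut, ← mul_add,
    pairing_comm _ ((K.liftSec σ Y).1 x), ← h, ← dir_sign_mul]
  congr 1
  exact funext fun y => K.metric_eq σ y _ _

theorem dorfman_liftSec_swap (σ : ℤˣ) (X Y : vectorFields E M) (x : M) :
    dorfman γ (K.liftSec (-σ) X) (K.liftSec σ Y) x
      = -dorfman γ (K.liftSec σ Y) (K.liftSec (-σ) X) x :=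
  dorfman_swap_of_pairing_eq_zero _ _ (fun _ => K.pairing_eq_zero (neg_neg σ).symm
    (K.lift_mem _ _ _) (K.lift_mem _ _ _)) x

/-- The generalized Bismut connection has totally skew-symmetric torsion. -/
theorem genBismut_torsion_skew (σ : ℤˣ) (X Y Z : vectorFields E M) (x : M) :
    K.metric x (K.genBismut σ X Y x - K.genBismut σ Y X x - lie X.1 Y.1 x) (Z.1 x)
      = -K.metric x (K.genBismut σ X Z x - K.genBismut σ Z X x - lie X.1 Z.1 x) (Y.1 x) := by
  -- `θ W` is the one-form `-2σ g(W, ·)`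
  let θ (W : vectorFields E M) : genFields E M := K.liftSec (-σ) W - K.liftSec σ W
  have hN (W : vectorFields E M) : K.liftSec (-σ) W = K.liftSec σ W + θ W :=
    Subtype.ext (funext fun _ => (add_sub_cancel _ _).symm)
  have hθ (W : vectorFields E M) (y : M) : ((θ W).1 y).1 = 0 := by
    change (K.lift (-σ) y (W.1 y)).1 - (K.lift σ y (W.1 y)).1 = 0
    simp
  have hθP (W W' : vectorFields E M) (y : M) :
      pairing ((θ W).1 y) ((K.liftSec σ W').1 y)
        = -pairing ((K.liftSec σ W).1 y) ((K.liftSec σ W').1 y) := by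
    change pairing (K.lift (-σ) y (W.1 y) - K.lift σ y (W.1 y)) (K.lift σ y (W'.1 y)) = _
    rw [pairing_sub_left, K.pairing_eq_zero (neg_neg σ).symm
      (K.lift_mem _ _ _) (K.lift_mem _ _ _), zero_sub]
    rfl
  have hlie (W W' : vectorFields E M) : pairing ((θ W).1 x)
      (dorfman γ (K.liftSec σ X) (K.liftSec σ W') x)
        = -(((σ : ℤ) : ℝ) * K.metric x (lie X.1 W'.1 x) (W.1 x)) := by
    have h1 : pairing ((θ W).1 x) (dorfman γ (K.liftSec σ X) (K.liftSec σ W') x)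
        = pairing ((θ W).1 x) (K.lift σ x (lie X.1 W'.1 x)) := by
      have h2 : (dorfman γ (K.liftSec σ X) (K.liftSec σ W') x).1 = lie X.1 W'.1 x := by
        simp only [dorfman, K.liftSec_fst]
      simp only [pairing, hθ, h2, lift_fst, map_zero]
    rw [h1, K.metric_eq σ, ← mul_assoc, sign_sq, one_mul]
    change pairing (K.lift (-σ) x (W.1 x) - K.lift σ x (W.1 x)) _ = _
    rw [pairing_sub_left, K.pairing_eq_zero (neg_neg σ).symm
      (K.lift_mem _ _ _) (K.lift_mem _ _ _), zero_sub, pairing_comm]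
  -- Writing the lift to `C_{-σ}` as the lift to `C_σ` plus `θ` expresses the torsion by brackets of
  -- `C_σ`-lifts with one correction by `θ` in each slot.
  have hT (W W' : vectorFields E M) :
      K.metric x (K.genBismut σ X W x - K.genBismut σ W X x - lie X.1 W.1 x) (W'.1 x)
        = ((σ : ℤ) : ℝ) *
          (2 * pairing (dorfman γ (K.liftSec σ X) (K.liftSec σ W) x) ((K.liftSec σ W').1 x)
            + pairing (dorfman γ (θ X) (K.liftSec σ W) x) ((K.liftSec σ W').1 x)
            + pairing (dorfman γ (K.liftSec σ X) (θ W) x) ((K.liftSec σ W').1 x))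
          - K.metric x (lie X.1 W.1 x) (W'.1 x) := by
    rw [K.metric_sub_left, K.metric_sub_left, K.metric_genBismut, K.metric_genBismut,
      K.dorfman_liftSec_swap σ W X, hN, hN, dorfman_add_left, dorfman_add_right, pairing_neg_left,
      pairing_add_left, pairing_add_left]
    ring
  have h1 := dir_pairing_eq (γ := γ) (K.liftSec σ X) (K.liftSec σ Y) (K.liftSec σ Z) x
  have h2 := dir_pairing_eq (γ := γ) (θ X) (K.liftSec σ Y) (K.liftSec σ Z) x
  have h3 := dir_pairing_eq (γ := γ) (K.liftSec σ X) (θ Y) (K.liftSec σ Z) x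
  have h4 := dir_pairing_eq (γ := γ) (K.liftSec σ X) (θ Z) (K.liftSec σ Y) x
  -- `θ X` has zero anchor, so the left side of `h2` vanishes. In `h3` and `h4` the derivative of
  -- the pairing reappears with a minus sign; these two copies cancel twice the one in `h1`, and the
  -- Lie bracket terms cancel those in `hT`.
  have h0 (f : M → ℝ) : dir (fun y => ((θ X).1 y).1) f x = 0 := by simp [dir, hθ]
  simp only [hθP, dir_neg, h0, hlie] at h1 h2 h3 h4
  simp only [pairing_comm ((K.liftSec σ Z).1 _)] at h4
  rw [pairing_comm ((K.liftSec σ Y).1 x)] at h1 h2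
  rw [hT, hT]
  have hσ := sign_sq σ
  linear_combination ((σ : ℤ) : ℝ) * (-2 * h1 - h2 - h3 - h4)
    + (K.metric x (lie X.1 Z.1 x) (Y.1 x) + K.metric x (lie X.1 Y.1 x) (Z.1 x)) * hσ

/-- The generalized Bismut connection preserves `I_σ`. -/
theorem proj_dorfman_J (σ : ℤˣ) (u v : genFields E M) (hu : ∀ x, u.1 x ∈ K.C (-σ) x)
    (hv : ∀ x, v.1 x ∈ K.C σ x) (x : M) :
    K.proj σ x (dorfman γ u (K.J.sec v) x) = K.J.toFun x (K.proj σ x (dorfman γ u v x)) := by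
  -- On `C_σ` one has `J' = σ J`, on `C_{-σ}` one has `J' = -σ J`. After projection to `C_σ`, the
  -- two identities therefore differ only in the signs of `Ju * v` and `Ju * Jv`, and their average
  -- is the claim.
  have h1 := K.integrable.nijenhuis u v x
  have h2 := K.integrable'.nijenhuis u v x
  have h1' := congrArg (K.proj σ x) h1
  have h2' := congrArg (K.proj σ x) h2
  rw [K.proj_J, map_add, map_sub] at h1'
  rw [K.proj_J', K.J'_eq (K.proj_mem _ _ _), map_add, map_sub] at h2'
  rcases Int.units_eq_one_or σ with rfl | rfl
  · have e1 : K.J'.sec u = -K.J.sec u := Subtype.ext (funext fun y => by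
      refine (K.J'_eq (hu y)).trans ?_
      rw [Units.val_neg, Units.val_one, Int.cast_neg, Int.cast_one]
      exact neg_one_smul ℝ (K.J.toFun y (u.1 y)))
    have e2 : K.J'.sec v = K.J.sec v := Subtype.ext (funext fun y => by
      refine (K.J'_eq (hv y)).trans ?_
      simp; rfl)
    rw [e1, e2, dorfman_neg_left, dorfman_neg_left] at h2'
    simp only [Units.val_one, Int.cast_one, one_smul, map_neg, map_sub] at h1' h2' ⊢
    linear_combination (norm := module) (2⁻¹ : ℝ) • h1' + (2⁻¹ : ℝ) • h2'
  · have e1 : K.J'.sec u = K.J.sec u := Subtype.ext (funext fun y => by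
      refine (K.J'_eq (hu y)).trans ?_
      simp; rfl)
    have e2 : K.J'.sec v = -K.J.sec v := Subtype.ext (funext fun y => by
      refine (K.J'_eq (hv y)).trans ?_
      rw [Units.val_neg, Units.val_one, Int.cast_neg, Int.cast_one]
      exact neg_one_smul ℝ (K.J.toFun y (v.1 y)))
    rw [e1, e2, dorfman_neg_right, dorfman_neg_right] at h2'
    simp only [Units.val_neg, Units.val_one, Int.cast_neg, Int.cast_one, map_neg,
      map_sub] at h1' h2' ⊢
    linear_combination (norm := module) (2⁻¹ : ℝ) • h1' - (2⁻¹ : ℝ) • h2'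

theorem genBismut_cplx (σ : ℤˣ) (X Y : vectorFields E M) (x : M) :
    K.genBismut σ X (K.cplxSec σ Y) x = K.cplx σ x (K.genBismut σ X Y x) := by
  have h : K.liftSec σ (K.cplxSec σ Y) = K.J.sec (K.liftSec σ Y) :=
    Subtype.ext (funext fun y => K.lift_cplx σ y (Y.1 y))
  rw [genBismut, h, K.proj_dorfman_J σ _ _ (fun y => K.lift_mem _ _ _) (fun y => K.lift_mem _ _ _)]
  simp only [genBismut, cplx, LinearMap.comp_apply, K.lift_proj]
  rfl

/-- The generalized Bismut connection is the only Bismut connection of `(g, I_σ)`. -/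
theorem genBismut_eq {σ : ℤˣ}
    {cov : CovariantDerivative 𝓘(ℝ, E) E (fun x : M => TangentSpace 𝓘(ℝ, E) x)}
    (h : IsBismut K.metric (K.cplx σ) cov) (X Y : vectorFields E M) (x : M) :
    K.genBismut σ X Y x = cov Y.1 x (X.1 x) := by
  -- The difference of the two connections is totally skew: in the last two slots by metricity
  -- (`h23`), in the outer ones by comparing the torsions (`h13`).
  let A (X Y Z : vectorFields E M) : ℝ :=
    K.metric x (K.genBismut σ X Y x - cov Y.1 x (X.1 x)) (Z.1 x)
  have h23 (X Y Z) : A X Y Z = -A X Z Y := by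
    have h1 := K.dir_metric σ X Y Z x
    have h2 := h.metric X Y Z x
    simp only [A, K.metric_sub_left]
    rw [K.metric_comm x (Y.1 x)] at h1 h2
    linarith
  have h13 (X Y Z) : A X Y Z = -A Z Y X := by
    have h1 := K.genBismut_torsion_skew σ Y X Z x
    have h2 := h.skew x (Y.1 x) (X.1 x) (Z.1 x)
    rw [cov.torsion_apply (vectorFields.mdiff Y.2 x) (vectorFields.mdiff X.2 x),
      cov.torsion_apply (vectorFields.mdiff Y.2 x) (vectorFields.mdiff Z.2 x)] at h2
    have h3 := h23 Y X Z
    simp only [A, K.metric_sub_left, lie] at h1 h2 h3 ⊢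
    linarith
  have hI (X Y Z) : A X (K.cplxSec σ Y) Z = -A X Y (K.cplxSec σ Z) := by
    simp only [A]
    rw [K.genBismut_cplx]
    have := h.complex X Y x
    change K.metric x (_ - cov (fun y => K.cplx σ y (Y.1 y)) x (X.1 x)) _ = _
    rw [this, ← map_sub, K.metric_cplx]
    rfl
  -- By `hI` and skewness, moving `I` from one slot of `A` to another costs a sign. Three moves
  -- bring it back to where it started, so the value equals its own negative.
  have hzero (X Y Z) : A X Y (K.cplxSec σ Z) = 0 := by
    linarith [h13 (K.cplxSec σ X) Y Z, hI Z Y X, h13 Z (K.cplxSec σ Y) X, hI X Y Z,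
      h23 (K.cplxSec σ X) Y Z, h13 (K.cplxSec σ X) Z Y, h23 Y Z (K.cplxSec σ X), hI Y X Z,
      h23 Y X (K.cplxSec σ Z), h13 Y (K.cplxSec σ Z) X, h23 X (K.cplxSec σ Z) Y]
  -- This `Z` makes `I Z` equal to the difference itself at `x`, whose norm is then zero.
  obtain ⟨Z, hZ, hZx⟩ := exists_vectorField (E := E) x
    (-K.cplx σ x (K.genBismut σ X Y x - cov Y.1 x (X.1 x)))
  have h1 := hzero X Y ⟨Z, hZ⟩
  change K.metric x _ (K.cplx σ x (Z x)) = 0 at h1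
  rw [hZx, map_neg, K.cplx_cplx, neg_neg] at h1
  exact sub_eq_zero.1 (K.eq_zero_of_metric_self h1)

end GenKahler

end Bismut

/-! ### Brackets of sections of `Lbar` in terms of the anti-holomorphic tangent bundles. -/

section ComplexBrackets

variable {E : Type*} [NormedAddCommGroup E] [NormedSpace ℝ E] [FiniteDimensional ℝ E]
  {M : Type*} [TopologicalSpace M] [T2Space M] [ChartedSpace E M] [IsManifold 𝓘(ℝ, E) ∞ M]
  {γ : ClosedThreeForm E M} (K : GenKahler γ)

theorem cxDorfman_add_left (s s' t : cxGenFields E M) (x : M) :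
    cxDorfman γ (s + s') t x = cxDorfman γ s t x + cxDorfman γ s' t x := by
  have h1 := dorfman_add_left (γ := γ) ⟨_, s.2.1⟩ ⟨_, s'.2.1⟩ ⟨_, t.2.1⟩ x
  have h2 := dorfman_add_left (γ := γ) ⟨_, s.2.2⟩ ⟨_, s'.2.2⟩ ⟨_, t.2.2⟩ x
  have h3 := dorfman_add_left (γ := γ) ⟨_, s.2.1⟩ ⟨_, s'.2.1⟩ ⟨_, t.2.2⟩ x
  have h4 := dorfman_add_left (γ := γ) ⟨_, s.2.2⟩ ⟨_, s'.2.2⟩ ⟨_, t.2.1⟩ x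
  exact Cx.ext ((congrArg₂ (· - ·) h1 h2).trans (add_sub_add_comm _ _ _ _))
    ((congrArg₂ (· + ·) h3 h4).trans (add_add_add_comm _ _ _ _))

theorem cxDorfman_add_right (s t t' : cxGenFields E M) (x : M) :
    cxDorfman γ s (t + t') x = cxDorfman γ s t x + cxDorfman γ s t' x := by
  have h1 := dorfman_add_right (γ := γ) ⟨_, s.2.1⟩ ⟨_, t.2.1⟩ ⟨_, t'.2.1⟩ x
  have h2 := dorfman_add_right (γ := γ) ⟨_, s.2.2⟩ ⟨_, t.2.2⟩ ⟨_, t'.2.2⟩ x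
  have h3 := dorfman_add_right (γ := γ) ⟨_, s.2.1⟩ ⟨_, t.2.2⟩ ⟨_, t'.2.2⟩ x
  have h4 := dorfman_add_right (γ := γ) ⟨_, s.2.2⟩ ⟨_, t.2.1⟩ ⟨_, t'.2.1⟩ x
  exact Cx.ext ((congrArg₂ (· - ·) h1 h2).trans (add_sub_add_comm _ _ _ _))
    ((congrArg₂ (· + ·) h3 h4).trans (add_add_add_comm _ _ _ _))

omit [FiniteDimensional ℝ E] [T2Space M] [IsManifold 𝓘(ℝ, E) ∞ M] in
theorem cxDir_add_left (X Y : Π x : M, Cx (Tan E x)) (f : M → ℂ) (x : M) :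
    cxDir (X + Y) f x = cxDir X f x + cxDir Y f x := by
  simp only [cxDir, dir, Pi.add_apply, Cx.add_re, Cx.add_im, map_add]
  ring

namespace GenKahler

omit [T2Space M] in
theorem cplx_re_of_mem_T01 {σ : ℤˣ} {x : M} {X : Cx (Tan E x)} (h : X ∈ K.T01 σ x) :
    K.cplx σ x X.re = X.im := by
  have := congrArg Cx.re (End.mem_eigenspace_iff.1 h)
  simpa using this

omit [T2Space M] in
theorem cxMap_lift_mem_eig {σ : ℤˣ} {x : M} {X : Cx (Tan E x)} (h : X ∈ K.T01 σ x) :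
    Cx.map (K.lift σ x) X ∈ K.J.eig (-Complex.I) x := by
  have h1 := End.mem_eigenspace_iff.1 h
  refine End.mem_eigenspace_iff.2 ?_
  rw [← map_smul, ← h1]
  ext1 <;> simp [K.lift_cplx]

omit [T2Space M] in
theorem cxMap_proj_mem_T01 (σ : ℤˣ) {x : M} {s : Cx (GTan E x)}
    (h : s ∈ K.J.eig (-Complex.I) x) : anchor E x (Cx.map (K.proj σ x) s) ∈ K.T01 σ x := by
  have h1 := End.mem_eigenspace_iff.1 h
  refine End.mem_eigenspace_iff.2 ?_
  rw [← map_smul, ← map_smul, ← h1]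
  ext1 <;> simp [anchor, cplx, K.lift_proj, K.proj_J]

/-- The isomorphism `a⁻¹ : T_{0,1}^σ M → lbar_σ ⊆ Lbar` on smooth sections. -/
def cxLift (σ : ℤˣ) : K.secT01 σ →ₗ[CFun E M] K.secLbar where
  toFun X := ⟨fun x => Cx.map (K.lift σ x) (X.1 x),
    ⟨K.lift_genFields σ X.2.1.1, K.lift_genFields σ X.2.1.2⟩,
    fun x => K.cxMap_lift_mem_eig (X.2.2 x)⟩
  map_add' _ _ := Subtype.ext (funext fun _ => map_add _ _ _)
  map_smul' f X := Subtype.ext (funext fun x => map_smul (Cx.map (K.lift σ x)) (f.1 x) (X.1 x))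

omit [T2Space M] in
/-- The projection `Lbar → lbar_σ ≅ T_{0,1}^σ M` on smooth sections. -/
def cxProj (σ : ℤˣ) : K.secLbar →ₗ[CFun E M] K.secT01 σ where
  toFun s := ⟨fun x => anchor E x (Cx.map (K.proj σ x) (s.1 x)),
    ⟨(K.proj_genFields σ s.2.1.1).1, (K.proj_genFields σ s.2.1.2).1⟩,
    fun x => K.cxMap_proj_mem_T01 σ (s.2.2 x)⟩
  map_add' s t := Subtype.ext (funext fun x =>
    map_add (anchor E x ∘ₗ Cx.map (K.proj σ x)) (s.1 x) (t.1 x))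
  map_smul' f s := Subtype.ext (funext fun x =>
    map_smul (anchor E x ∘ₗ Cx.map (K.proj σ x)) (f.1 x) (s.1 x))

theorem anchor_cxLift (σ : ℤˣ) (X : K.secT01 σ) (x : M) :
    anchor E x ((K.cxLift σ X).1 x) = X.1 x :=
  Cx.ext (K.lift_fst σ x _) (K.lift_fst σ x _)

omit [T2Space M] in
theorem anchor_proj_lift (σ : ℤˣ) {x : M} (w : Cx (Tan E x)) :
    anchor E x (Cx.map (K.proj σ x) (Cx.map (K.lift σ x) w)) = w := by
  have h (Y : Tan E x) : (K.proj σ x (K.lift σ x Y)).1 = Y := by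
    rw [K.proj_of_mem (K.lift_mem σ x Y), K.lift_fst]
  exact Cx.ext (h _) (h _)

theorem cxProj_cxLift (σ : ℤˣ) (X : K.secT01 σ) : K.cxProj σ (K.cxLift σ X) = X :=
  Subtype.ext (funext fun x => K.anchor_proj_lift σ (X.1 x))

omit [T2Space M] in
theorem proj_of_mem_neg {σ τ : ℤˣ} (h : τ = -σ) {x : M} {u : GTan E x} (hu : u ∈ K.C σ x) :
    K.proj τ x u = 0 := by
  have := K.proj_add_proj σ x u
  rw [K.proj_of_mem hu, ← h] at this
  exact left_eq_add.1 this.symm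

omit [T2Space M] in
theorem anchor_proj_lift_neg {σ τ : ℤˣ} (h : τ = -σ) {x : M} (w : Cx (Tan E x)) :
    anchor E x (Cx.map (K.proj τ x) (Cx.map (K.lift σ x) w)) = 0 := by
  have h (Y : Tan E x) : (K.proj τ x (K.lift σ x Y)).1 = 0 := by
    rw [K.proj_of_mem_neg h (K.lift_mem σ x Y)]; rfl
  exact Cx.ext (h _) (h _)

theorem cxProj_cxLift_neg {σ τ : ℤˣ} (h : τ = -σ) (X : K.secT01 σ) :
    K.cxProj τ (K.cxLift σ X) = 0 :=
  Subtype.ext (funext fun x => K.anchor_proj_lift_neg h (X.1 x))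

theorem cxLift_cxProj_add (s : K.secLbar) :
    K.cxLift 1 (K.cxProj 1 s) + K.cxLift (-1) (K.cxProj (-1) s) = s := by
  refine Subtype.ext (funext fun x => ?_)
  have h (u : GTan E x) :
      K.lift 1 x (K.proj 1 x u).1 + K.lift (-1) x (K.proj (-1) x u).1 = u := by
    rw [K.lift_proj, K.lift_proj, K.proj_add_proj]
  exact Cx.ext (h _) (h _)

-- On `lbar_σ` the product `J J'` acts by `(-i)(-σ i) = -σ`, so the complexified `G` acts by the
-- real number `σ`, on real and imaginary parts separately.
omit [T2Space M] in
theorem mem_C_of_mem_lbar {σ : ℤˣ} {x : M} {s : Cx (GTan E x)} (h : s ∈ K.lbar σ x) :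
    s.re ∈ K.C σ x ∧ s.im ∈ K.C σ x := by
  have h1 := End.mem_eigenspace_iff.1 h.1
  have h2 := End.mem_eigenspace_iff.1 h.2
  have h3 : Cx.map (K.J.toFun x) (Cx.map (K.J'.toFun x) s) = (-((σ : ℤ) : ℂ)) • s := by
    rw [h2, map_smul, h1, smul_smul]
    congr 1
    linear_combination ((σ : ℤ) : ℂ) * Complex.I_mul_I
  have h4 := congrArg Cx.re h3
  have h5 := congrArg Cx.im h3
  simp only [Cx.map_re, Cx.map_im, Cx.smul_re, Cx.smul_im, Complex.neg_re, Complex.neg_im,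
    Complex.intCast_re, Complex.intCast_im] at h4 h5
  constructor
  · rw [mem_C_iff]
    simp only [G, LinearMap.neg_apply, LinearMap.comp_apply, h4]
    module
  · rw [mem_C_iff]
    simp only [G, LinearMap.neg_apply, LinearMap.comp_apply, h5]
    module

theorem cxLift_eq_of_mem_lbar {σ : ℤˣ} {s : K.secLbar} {X : K.secT01 σ}
    (hs : ∀ x, s.1 x ∈ K.lbar σ x) (hX : ∀ x, X.1 x = anchor E x (s.1 x)) :
    K.cxLift σ X = s := by
  refine Subtype.ext (funext fun x => ?_)
  obtain ⟨h1, h2⟩ := K.mem_C_of_mem_lbar (hs x)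
  change Cx.map (K.lift σ x) (X.1 x) = s.1 x
  rw [hX]
  exact Cx.ext (K.lift_eq_of_mem h1) (K.lift_eq_of_mem h2)

/-- Let `d` be this difference. Since `J' = σ J` on `C_σ`, passing from `J` to `J'` leaves `d`
unchanged and multiplies the other side of the Nijenhuis identity by `σ`. Hence `J' d = σ J d`, that
is, `G d = σ d`. -/
theorem dorfman_sub_mem_C {σ : ℤˣ} (u v : genFields E M) (hu : ∀ x, u.1 x ∈ K.C σ x)
    (hv : ∀ x, v.1 x ∈ K.C σ x) (x : M) :
    dorfman γ u v x - dorfman γ (K.J.sec u) (K.J.sec v) x ∈ K.C σ x := by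
  have h1 := K.integrable.nijenhuis u v x
  have h2 := K.integrable'.nijenhuis u v x
  rw [mem_C_iff]
  simp only [G, LinearMap.neg_apply, LinearMap.comp_apply]
  rcases Int.units_eq_one_or σ with rfl | rfl
  · have e (w : genFields E M) (hw : ∀ x, w.1 x ∈ K.C 1 x) : K.J'.sec w = K.J.sec w :=
      Subtype.ext (funext fun y => by
        refine (K.J'_eq (hw y)).trans ?_
        rw [Units.val_one, Int.cast_one]
        exact one_smul ℝ (K.J.toFun y (w.1 y)))
    rw [e u hu, e v hv, h1] at h2
    rw [← h2, K.J.sq, neg_neg, Units.val_one, Int.cast_one]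
    exact (one_smul ℝ _).symm
  · have e (w : genFields E M) (hw : ∀ x, w.1 x ∈ K.C (-1) x) : K.J'.sec w = -K.J.sec w :=
      Subtype.ext (funext fun y => by
        refine (K.J'_eq (hw y)).trans ?_
        rw [Units.val_neg, Units.val_one, Int.cast_neg, Int.cast_one]
        exact neg_one_smul ℝ (K.J.toFun y (w.1 y)))
    rw [e u hu, e v hv, dorfman_neg_left, dorfman_neg_right, dorfman_neg_left, dorfman_neg_right,
      neg_neg, ← neg_add, h1] at h2
    rw [← h2, map_neg, K.J.sq, neg_neg, Units.val_neg, Units.val_one, Int.cast_neg, Int.cast_one]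
    exact (neg_one_smul ℝ _).symm

/-- The complex Courant-Dorfman bracket of sections of `Lbar`. -/
abbrev bracket (s t : K.secLbar) (x : M) : Cx (GTan E x) :=
  cxDorfman γ ⟨s.1, s.2.1⟩ ⟨t.1, t.2.1⟩ x

/-- The map `a⁻¹` from the anti-holomorphic tangent bundle of `I_σ` preserves brackets. -/
theorem bracket_cxLift (σ : ℤˣ) (X Y : K.secT01 σ) (x : M) :
    K.bracket (K.cxLift σ X) (K.cxLift σ Y) x = Cx.map (K.lift σ x) (cxLie X.1 Y.1 x) := by
  let u : genFields E M := ⟨_, (K.cxLift σ X).2.1.1⟩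
  let v : genFields E M := ⟨_, (K.cxLift σ Y).2.1.1⟩
  -- The lifts have the form `u + i J u` and `v + i J v`. The real part of their bracket is `u * v -
  -- Ju * Jv`, which lies in `C_σ`, and the imaginary part is `J` of it. So the bracket is recovered
  -- from its anchor.
  have hJ (Z : K.secT01 σ) : (⟨_, (K.cxLift σ Z).2.1.2⟩ : genFields E M)
      = K.J.sec ⟨_, (K.cxLift σ Z).2.1.1⟩ := Subtype.ext (funext fun y => by
    change K.lift σ y (Z.1 y).im = K.J.toFun y (K.lift σ y (Z.1 y).re)
    rw [← K.lift_cplx, K.cplx_re_of_mem_T01 (Z.2.2 y)])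
  have hC := K.dorfman_sub_mem_C u v (fun y => K.lift_mem _ _ _) (fun y => K.lift_mem _ _ _) x
  have hN := K.integrable.nijenhuis u v x
  have hfst (Z : K.secT01 σ) : (fun y => ((K.cxLift σ Z).1 y).re.1) = fun y => (Z.1 y).re :=
    funext fun y => K.lift_fst σ y _
  have hfst' (Z : K.secT01 σ) : (fun y => ((K.cxLift σ Z).1 y).im.1) = fun y => (Z.1 y).im :=
    funext fun y => K.lift_fst σ y _
  have key : anchor E x (K.bracket (K.cxLift σ X) (K.cxLift σ Y) x) = cxLie X.1 Y.1 x := by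
    refine Cx.ext ?_ ?_ <;>
      simp only [anchor, bracket, cxDorfman, dorfman, cxLie, Cx.map_re, Cx.map_im, Cx.mk_re,
        Cx.mk_im, LinearMap.fst_apply, Prod.fst_sub, Prod.fst_add, hfst, hfst']
  have hre : (K.bracket (K.cxLift σ X) (K.cxLift σ Y) x).re ∈ K.C σ x := by
    simp only [bracket, cxDorfman, Cx.mk_re]
    rw [hJ, hJ]
    exact hC
  have him : (K.bracket (K.cxLift σ X) (K.cxLift σ Y) x).im ∈ K.C σ x := by
    simp only [bracket, cxDorfman, Cx.mk_im]
    rw [hJ, hJ]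
    rw [hN]
    exact K.J_mem hC
  rw [← key]
  refine Cx.ext ?_ ?_
  exacts [(K.lift_eq_of_mem hre).symm, (K.lift_eq_of_mem him).symm]

variable {covp covm : CovariantDerivative 𝓘(ℝ, E) E (fun x : M => TangentSpace 𝓘(ℝ, E) x)}
  (hp : IsBismut K.metric (K.cplx 1) covp) (hm : IsBismut K.metric (K.cplx (-1)) covm)

include hp hm

/-- The mixed brackets are given by the Bismut connections. -/
theorem dorfman_liftSec_mixed (X Y : vectorFields E M) (x : M) :
    dorfman γ (K.liftSec 1 X) (K.liftSec (-1) Y) x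
      = K.lift (-1) x (covm Y.1 x (X.1 x)) - K.lift 1 x (covp X.1 x (Y.1 x)) := by
  have h1 := K.genBismut_eq hm X Y x
  have h2 := K.genBismut_eq hp Y X x
  have h3 := K.dorfman_liftSec_swap 1 Y X x
  -- The `C_-` component of the bracket is `∇^-_X Y` by definition of `genBismut`; the `C_+`
  -- component becomes `-∇^+_Y X` after exchanging the arguments.
  rw [← h1, ← h2, genBismut, genBismut, K.lift_proj, K.lift_proj, neg_neg, h3, map_neg,
    sub_neg_eq_add, add_comm]
  exact (K.proj_add_proj 1 x _).symm

theorem bracket_cxLift_mixed (X : K.secT01 1) (Y : K.secT01 (-1)) (x : M) :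
    K.bracket (K.cxLift 1 X) (K.cxLift (-1) Y) x
      = (K.cxLift (-1) (bismutAlong hm X Y) - K.cxLift 1 (bismutAlong hp Y X)).1 x := by
  have h (X Y : vectorFields E M) := K.dorfman_liftSec_mixed hp hm X Y x
  have h1 := h ⟨_, X.2.1.1⟩ ⟨_, Y.2.1.1⟩
  have h2 := h ⟨_, X.2.1.2⟩ ⟨_, Y.2.1.2⟩
  have h3 := h ⟨_, X.2.1.1⟩ ⟨_, Y.2.1.2⟩
  have h4 := h ⟨_, X.2.1.2⟩ ⟨_, Y.2.1.1⟩
  refine Cx.ext ((congrArg₂ (· - ·) h1 h2).trans ?_) ((congrArg₂ (· + ·) h3 h4).trans ?_)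
  · change _ = K.lift (-1) x (_ - _) - K.lift 1 x (_ - _)
    rw [map_sub, map_sub]
    abel
  · change _ = K.lift (-1) x (_ + _) - K.lift 1 x (_ + _)
    rw [map_add, map_add]
    abel

omit hp hm in
theorem bracket_cxLift_swap (X : K.secT01 1) (Y : K.secT01 (-1)) (x : M) :
    K.bracket (K.cxLift (-1) Y) (K.cxLift 1 X) x
      = -K.bracket (K.cxLift 1 X) (K.cxLift (-1) Y) x := by
  have h (X Y : vectorFields E M) := K.dorfman_liftSec_swap 1 Y X x
  have h1 := h ⟨_, X.2.1.1⟩ ⟨_, Y.2.1.1⟩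
  have h2 := h ⟨_, X.2.1.2⟩ ⟨_, Y.2.1.2⟩
  have h3 := h ⟨_, X.2.1.1⟩ ⟨_, Y.2.1.2⟩
  have h4 := h ⟨_, X.2.1.2⟩ ⟨_, Y.2.1.1⟩
  refine Cx.ext ((congrArg₂ (· - ·) h1 h2).trans ?_) ((congrArg₂ (· + ·) h4 h3).trans ?_)
  · exact (neg_sub_neg _ _).trans (neg_sub _ _).symm
  · exact (add_comm _ _).trans (neg_add _ _).symm

end GenKahler

end ComplexBrackets

/-! ### The bijection between the two kinds of structures. -/

section Correspondence

variable {E : Type*} [NormedAddCommGroup E] [NormedSpace ℝ E] [FiniteDimensional ℝ E]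
  {M : Type*} [TopologicalSpace M] [T2Space M] [ChartedSpace E M] [IsManifold 𝓘(ℝ, E) ∞ M]
  {γ : ClosedThreeForm E M} {K : GenKahler γ}
  {F : Type*} [NormedAddCommGroup F] [NormedSpace ℂ F]
  {V : M → Type*} [TopologicalSpace (TotalSpace F V)] [∀ x, AddCommGroup (V x)]
  [∀ x, Module ℂ (V x)] [∀ x, TopologicalSpace (V x)] [FiberBundle F V] [VectorBundle ℂ F V]
  [VectorBundle ℝ F V]

section PartialConnection

variable {W : M → Type*} [∀ x, AddCommGroup (W x)] [∀ x, Module ℂ (W x)]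
  {A : Submodule (CFun E M) (Π x, W x)} {ρ : ∀ x, W x →ₗ[ℂ] Cx (Tan E x)}
  (D : PartialConnection F V A ρ)

omit [FiniteDimensional ℝ E] [T2Space M]

theorem PartialConnection.toFun_add (s t : A) (v : sections E F V) :
    D.toFun (s + t) v = D.toFun s v + D.toFun t v := by
  rw [LinearMap.map_add]; rfl

theorem PartialConnection.toFun_sub (s t : A) (v : sections E F V) :
    D.toFun (s - t) v = D.toFun s v - D.toFun t v :=
  DFunLike.congr_fun (LinearMap.map_sub D.toFun s t) v

theorem PartialConnection.toFun_zero (v : sections E F V) : D.toFun 0 v = 0 := by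
  rw [LinearMap.map_zero]; rfl

end PartialConnection

/-- The `(0,1)`-connection induced by a connection along `Lbar`. -/
def LbarConnection.dolbeault (D : LbarConnection F V K) (σ : ℤˣ) : DolbeaultOperator F V K σ where
  toFun := D.toFun ∘ₗ K.cxLift σ
  leibniz X f v x := by
    have h := D.leibniz (K.cxLift σ X) f v x
    simp only [K.anchor_cxLift] at h
    exact h

/-- The connection along `Lbar` determined by a pair of `(0,1)`-connections. -/
def lbarConnection (dp : DolbeaultOperator F V K 1) (dm : DolbeaultOperator F V K (-1)) :
    LbarConnection F V K where
  toFun := dp.toFun ∘ₗ K.cxProj 1 + dm.toFun ∘ₗ K.cxProj (-1)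
  leibniz s f v x := by
    have h1 := dp.leibniz (K.cxProj 1 s) f v x
    have h2 := dm.leibniz (K.cxProj (-1) s) f v x
    have h3 : (fun y => anchor E y (s.1 y))
        = (K.cxProj 1 s).1 + (K.cxProj (-1) s).1 := funext fun y => by
      conv_lhs => rw [← K.cxLift_cxProj_add s]
      exact (map_add _ _ _).trans
        (congrArg₂ (· + ·) (K.anchor_cxLift 1 _ y) (K.anchor_cxLift (-1) _ y))
    rw [h3, cxDir_add_left, add_smul]
    change (dp.toFun (K.cxProj 1 s) (f • v)).1 x + (dm.toFun (K.cxProj (-1) s) (f • v)).1 x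
      = f.1 x • ((dp.toFun (K.cxProj 1 s) v).1 x + (dm.toFun (K.cxProj (-1) s) v).1 x) + _
    rw [h1, h2, smul_add]
    simp only [LinearMap.id_apply]
    abel

theorem lbarConnection_toFun (dp : DolbeaultOperator F V K 1) (dm : DolbeaultOperator F V K (-1))
    (s : K.secLbar) (v : sections E F V) :
    (lbarConnection dp dm).toFun s v
      = dp.toFun (K.cxProj 1 s) v + dm.toFun (K.cxProj (-1) s) v := rfl

variable {covp covm : CovariantDerivative 𝓘(ℝ, E) E (fun x : M => TangentSpace 𝓘(ℝ, E) x)}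
  (hp : IsBismut K.metric (K.cplx 1) covp) (hm : IsBismut K.metric (K.cplx (-1)) covm)

-- The sign in `swapNeg` turns the sum of second-order terms into an ordinary commutator. Given
-- `bracket_cxLift_mixed`, the right-hand side is exactly the defect of flatness on a mixed pair of
-- lifts.
omit [T2Space M] in
theorem commutator_eq (dp : DolbeaultOperator F V K 1) (dm : DolbeaultOperator F V K (-1))
    (v : sections E F V) (X : K.secT01 1) (Y : K.secT01 (-1)) :
    commutator hp hm dp dm v X Y
      = dp.toFun X (dm.toFun Y v) - dm.toFun Y (dp.toFun X v)
        - (dm.toFun (bismutAlong hm X Y) v - dp.toFun (bismutAlong hp Y X) v) := by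
  change dp.toFun X (dm.toFun Y v) - dm.toFun (bismutAlong hm X Y) v
    + -(dm.toFun Y (dp.toFun X v) - dp.toFun (bismutAlong hp Y X) v) = _
  abel

/-- The holomorphic structures induced by a generalized holomorphic structure. -/
def GenHolStructure.hol (D : GenHolStructure F V K) (σ : ℤˣ) : HolStructure F V K σ where
  D := LbarConnection.dolbeault D.D σ
  flat X Y Z hZ v := D.flat (K.cxLift σ X) (K.cxLift σ Y) (K.cxLift σ Z) (funext fun x => by
    refine Eq.trans ?_ (K.bracket_cxLift σ X Y x).symm
    exact congrArg (Cx.map (K.lift σ x)) (congrFun hZ x)) v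

/-- A generalized holomorphic structure induces a commuting pair of holomorphic structures. -/
def GenHolStructure.toCommuting (D : GenHolStructure F V K) :
    CommutingHolStructure V F hp hm where
  plus := D.hol 1
  minus := D.hol (-1)
  commute v X Y := by
    have h := D.flat (K.cxLift 1 X) (K.cxLift (-1) Y)
      (K.cxLift (-1) (bismutAlong hm X Y) - K.cxLift 1 (bismutAlong hp Y X))
      (funext fun x => (K.bracket_cxLift_mixed hp hm X Y x).symm) v
    rw [D.D.toFun_sub] at h
    rw [commutator_eq]
    exact sub_eq_zero.2 h

/-- The bracket of two sections of `Lbar`, decomposed along `Lbar = lbar_+ ⊕ lbar_-`. -/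
theorem GenKahler.bracket_eq (s t : K.secLbar) (x : M) :
    K.bracket s t x =
      Cx.map (K.lift 1 x) (cxLie (K.cxProj 1 s).1 (K.cxProj 1 t).1 x)
      + Cx.map (K.lift (-1) x) (cxLie (K.cxProj (-1) s).1 (K.cxProj (-1) t).1 x)
      + (Cx.map (K.lift (-1) x) ((bismutAlong hm (K.cxProj 1 s) (K.cxProj (-1) t)).1 x)
        - Cx.map (K.lift 1 x) ((bismutAlong hp (K.cxProj (-1) t) (K.cxProj 1 s)).1 x)
        - (Cx.map (K.lift (-1) x) ((bismutAlong hm (K.cxProj 1 t) (K.cxProj (-1) s)).1 x)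
          - Cx.map (K.lift 1 x) ((bismutAlong hp (K.cxProj (-1) s) (K.cxProj 1 t)).1 x))) := by
  set X := K.cxProj 1 s
  set Y := K.cxProj (-1) s
  set X' := K.cxProj 1 t
  set Y' := K.cxProj (-1) t
  have h1 : s = K.cxLift 1 X + K.cxLift (-1) Y := (K.cxLift_cxProj_add s).symm
  have h2 : t = K.cxLift 1 X' + K.cxLift (-1) Y' := (K.cxLift_cxProj_add t).symm
  have hl (a b c : K.secLbar) : K.bracket (a + b) c x = K.bracket a c x + K.bracket b c x :=
    cxDorfman_add_left ⟨a.1, a.2.1⟩ ⟨b.1, b.2.1⟩ ⟨c.1, c.2.1⟩ x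
  have hr (a b c : K.secLbar) : K.bracket a (b + c) x = K.bracket a b x + K.bracket a c x :=
    cxDorfman_add_right ⟨a.1, a.2.1⟩ ⟨b.1, b.2.1⟩ ⟨c.1, c.2.1⟩ x
  have h3 : K.bracket s t x = K.bracket (K.cxLift 1 X) (K.cxLift 1 X') x
      + K.bracket (K.cxLift (-1) Y) (K.cxLift (-1) Y') x
      + (K.bracket (K.cxLift 1 X) (K.cxLift (-1) Y') x
        - K.bracket (K.cxLift 1 X') (K.cxLift (-1) Y) x) := by
    conv_lhs => rw [h1, h2]
    rw [hl, hr, hr, K.bracket_cxLift_swap X' Y x]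
    abel
  rw [h3, K.bracket_cxLift, K.bracket_cxLift, K.bracket_cxLift_mixed hp hm,
    K.bracket_cxLift_mixed hp hm]
  rfl

/-- Bookkeeping for `toGenHol`: `a, b` are the second-order terms of equal sign, `c, e` the mixed
ones, primes on `a, b, c, e` the reversed order. The `p`'s and `q`'s are the `∇^+` and `∇^-` terms,
and `k, l` the two components of `D_[s,t] v`. -/
theorem add_eq_of_commutators {G : Type*} [AddCommGroup G]
    {a a' b b' c c' e e' p p' q q' k l : G} (h1 : a - a' = k + p - p') (h2 : b - b' = l - q + q')
    (h3 : c - c' - (q - p) = 0) (h4 : e - e' - (q' - p') = 0) :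
    a + e' + (c + b) - (a' + c' + (e + b')) = k + l := by
  have h5 : a + e' + (c + b) - (a' + c' + (e + b'))
      = (a - a') + (b - b') + (c - c' - (q - p)) - (e - e' - (q' - p')) + (q - p) - (q' - p') := by
    abel
  rw [h5, h1, h2, h3, h4]
  abel

/-- A commuting pair of holomorphic structures determines a generalized holomorphic structure. -/
def CommutingHolStructure.toGenHol (d : CommutingHolStructure V F hp hm) :
    GenHolStructure F V K where
  D := lbarConnection d.plus.D d.minus.D
  flat s t r hr v := by
    set X := K.cxProj 1 s
    set Y := K.cxProj (-1) s
    set X' := K.cxProj 1 t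
    set Y' := K.cxProj (-1) t
    have hr' (x : M) := (congrFun hr x).trans (K.bracket_eq hp hm s t x)
    have hP (x : M) : (K.cxProj 1 r).1 x
        = cxLie X.1 X'.1 x - (bismutAlong hp Y' X).1 x + (bismutAlong hp Y X').1 x := by
      change anchor E x (Cx.map (K.proj 1 x) (r.1 x)) = _
      rw [hr' x]
      simp only [map_add, map_sub, K.anchor_proj_lift,
        K.anchor_proj_lift_neg (σ := -1) (τ := 1) (neg_neg 1).symm]
      abel
    have hQ (x : M) : (K.cxProj (-1) r).1 x
        = cxLie Y.1 Y'.1 x + (bismutAlong hm X Y').1 x - (bismutAlong hm X' Y).1 x := by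
      change anchor E x (Cx.map (K.proj (-1) x) (r.1 x)) = _
      rw [hr' x]
      simp only [map_add, map_sub, K.anchor_proj_lift,
        K.anchor_proj_lift_neg (σ := 1) (τ := -1) rfl]
      abel
    -- `IsFlat` asks for a smooth section equal to the Lie bracket of `X` and `X'`; solving `hP` for
    -- that bracket provides one.
    have h1 := d.plus.flat X X' (K.cxProj 1 r + bismutAlong hp Y' X - bismutAlong hp Y X')
      (funext fun x => by
        change (K.cxProj 1 r).1 x + (bismutAlong hp Y' X).1 x - (bismutAlong hp Y X').1 x = _
        rw [hP]; abel) v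
    have h2 := d.minus.flat Y Y' (K.cxProj (-1) r - bismutAlong hm X Y' + bismutAlong hm X' Y)
      (funext fun x => by
        change (K.cxProj (-1) r).1 x - (bismutAlong hm X Y').1 x + (bismutAlong hm X' Y).1 x = _
        rw [hQ]; abel) v
    have h3 := d.commute v X Y'
    have h4 := d.commute v X' Y
    rw [commutator_eq] at h3 h4
    rw [PartialConnection.toFun_sub, PartialConnection.toFun_add] at h1
    rw [PartialConnection.toFun_add, PartialConnection.toFun_sub] at h2
    simp only [lbarConnection_toFun, AddMonoidHom.map_add]
    exact add_eq_of_commutators (G := sections E F V) h1 h2 h3 h4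

/-- Generalized holomorphic structures correspond to commuting pairs of holomorphic structures. -/
def genHolEquiv : GenHolStructure F V K ≃ CommutingHolStructure V F hp hm where
  toFun D := D.toCommuting hp hm
  invFun d := d.toGenHol hp hm
  left_inv D := by
    obtain ⟨D, hD⟩ := D
    have : lbarConnection (D.dolbeault 1) (D.dolbeault (-1)) = D := by
      refine PartialConnection.ext (LinearMap.ext fun s => AddMonoidHom.ext fun v => ?_)
      change D.toFun (K.cxLift 1 (K.cxProj 1 s)) v
        + D.toFun (K.cxLift (-1) (K.cxProj (-1) s)) v = _
      rw [← D.toFun_add, K.cxLift_cxProj_add]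
    simp only [CommutingHolStructure.toGenHol, GenHolStructure.toCommuting, GenHolStructure.hol,
      this]
  right_inv d := by
    obtain ⟨⟨dp, hdp⟩, ⟨dm, hdm⟩, hd⟩ := d
    have h1 : (lbarConnection dp dm).dolbeault 1 = dp := by
      refine PartialConnection.ext (LinearMap.ext fun X => AddMonoidHom.ext fun v => ?_)
      change dp.toFun (K.cxProj 1 (K.cxLift 1 X)) v
        + dm.toFun (K.cxProj (-1) (K.cxLift 1 X)) v = _
      rw [K.cxProj_cxLift, K.cxProj_cxLift_neg rfl, dm.toFun_zero, add_zero]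
    have h2 : (lbarConnection dp dm).dolbeault (-1) = dm := by
      refine PartialConnection.ext (LinearMap.ext fun X => AddMonoidHom.ext fun v => ?_)
      change dp.toFun (K.cxProj 1 (K.cxLift (-1) X)) v
        + dm.toFun (K.cxProj (-1) (K.cxLift (-1) X)) v = _
      rw [K.cxProj_cxLift, K.cxProj_cxLift_neg (neg_neg 1).symm, dp.toFun_zero, zero_add]
    simp only [CommutingHolStructure.toGenHol, GenHolStructure.toCommuting, GenHolStructure.hol,
      h1, h2]

theorem GenHolStructure.induces_hol (D : GenHolStructure F V K) (σ : ℤˣ) :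
    Induces D.D (D.hol σ).D := by
  intro s X hs hX v
  change D.D.toFun (K.cxLift σ X) v = _
  rw [K.cxLift_eq_of_mem_lbar hs hX]

end Correspondence

end GK

end

theorem proposition2p13
    {E : Type*} [NormedAddCommGroup E] [NormedSpace ℝ E] [FiniteDimensional ℝ E]
    {M : Type*} [TopologicalSpace M] [T2Space M] [SigmaCompactSpace M] [ChartedSpace E M]
    [IsManifold 𝓘(ℝ, E) ∞ M]
    {γ : GK.ClosedThreeForm E M} (K : GK.GenKahler γ)
    (F : Type*) [NormedAddCommGroup F] [NormedSpace ℂ F] [FiniteDimensional ℂ F]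
    (V : M → Type*) [TopologicalSpace (TotalSpace F V)] [∀ x, AddCommGroup (V x)]
    [∀ x, Module ℂ (V x)] [∀ x, TopologicalSpace (V x)] [FiberBundle F V] [VectorBundle ℂ F V]
    [VectorBundle ℝ F V] [ContMDiffVectorBundle ∞ F V 𝓘(ℝ, E)]
    {covp covm : CovariantDerivative 𝓘(ℝ, E) E (fun x : M => TangentSpace 𝓘(ℝ, E) x)}
    (hp : GK.IsBismut K.metric (K.cplx 1) covp)
    (hm : GK.IsBismut K.metric (K.cplx (-1)) covm) :
    ∃ Φ : GK.GenHolStructure F V K ≃ GK.CommutingHolStructure V F hp hm,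
      ∀ D : GK.GenHolStructure F V K,
        GK.Induces D.D (Φ D).plus.D ∧ GK.Induces D.D (Φ D).minus.D := 
  ⟨GK.genHolEquiv hp hm, fun D => ⟨D.induces_hol 1, D.induces_hol (-1)⟩⟩
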